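/- **Setting.** There are $n$ agents $X=\{1,\dots,n\}$. Agent $i$ has a monotone utility $u_i(S)\in[0,1]$ for $S\subseteq X\setminus\{i\}$, with $u_i(\emptyset)=0$, normalized so that $\max_i u_i(X\setminus\{i\})=1$, and shares $h_{ij}(S)$, $j\in S$, with $\sum_{j\in S}h_{ij}(S)=u_i(S)$, which are cross-monotonic: $h_{ij}(T)\ge h_{ij}(S)$ whenever $j\in T\subseteq S$ (for example, submodular utilities with Shapley value shares). A *lottery* is a family $x_{iS}\ge 0$ ($S\subseteq X\setminus\{i\}$) with $\sum_S x_{iS}\le 1$ for every $i$. It is *$\epsilon$-balanced* if for every $i$ $$\Bigl|\sum_S\sum_{j\in S}h_{ij}(S)x_{iS}-\sum_j\sum_{S\ni i}h_{ji}(S)x_{jS}\Bigr|\le\epsilon ,$$ and *feasible* if the two sums are equal for every $i$. Put $u_i(x)=\sum_S u_i(S)x_{iS}$; the social welfare of $x$ is $\sum_i u_i(x)$. For $\alpha\in[1,\infty]$, a lottery $x$ is *$\alpha$-approximately 2-stable* if there are no nonempty set $U$ of at most two agents and feasible lottery $y$ with trades only among the agents of $U$ such that $u_i(y)>\alpha\,u_i(x)$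 for all $i\in U$ (for $\alpha=\infty$ this always holds). **Statement.** There are an algorithm, a constant $C$ and a polynomial $p$ such that for all such instances, all $\epsilon\in(0,1)$ and all $\beta\in(0,1]$, the algorithm, given $n$, $\epsilon$, $\beta$ and access to a subroutine that returns $u_i(S)$ and $h_{ij}(S)$ on request, performs at most $p(n,1/\epsilon)$ subroutine calls and elementary operations (real arithmetic and comparisons at unit cost) and outputs, as a list of its nonzero probabilities, an $\epsilon$-balanced lottery $x$ such that * the social welfare of every $\epsilon$-balanced lottery (in particular, of every feasible one) is at most $\dfrac{C\,\log\max(n,1/\epsilon)}{\beta}$ times the social welfare of $x$; so $x$ is an $O\!\left(\frac{\log n}{\beta}\right)$-approximation to social welfare for every fixed $\epsilon$, with an absolute constant once $n\ge 1/\epsilon$; * $x$ is $\frac1{1-\beta}$-approximately 2-stable (with $\frac1{1-\beta}=\infty$ for $\beta=1$). -/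

import Mathlib

open Finset

/-- A data exchange instance with agents `Fin n`.  `u i S` is the utility of agent `i` for the
datasets of the agents in `S`, and `h i j S` is the share of it that is attributed to `j ∈ S`.
Only sets `S` not containing `i` are meaningful. -/
structure DataExchange (n : ℕ) where
  u : Fin n → Finset (Fin n) → ℝ
  h : Fin n → Fin n → Finset (Fin n) → ℝ
  u_empty : ∀ i, u i ∅ = 0
  u_nonneg : ∀ i S, i ∉ S → 0 ≤ u i S
  u_le_one : ∀ i S, i ∉ S → u i S ≤ 1
  u_mono : ∀ i S T, i ∉ S → T ⊆ S → u i T ≤ u i S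
  sum_share : ∀ i S, i ∉ S → ∑ j ∈ S, h i j S = u i S

namespace DataExchange

variable {n : ℕ}

/-- The normalization `max_i u_i(X \ {i}) = 1` (all utilities are at most `1` anyway). -/
def Normalized (E : DataExchange n) : Prop :=
  ∃ i, E.u i (univ.erase i) = 1

/-- Cross-monotonic sharing: the share of `j` can only drop when more agents contribute. -/
def CrossMonotone (E : DataExchange n) : Prop :=
  ∀ i S T j, i ∉ S → T ⊆ S → j ∈ T → E.h i j S ≤ E.h i j T

/-- The sets of agents whose data `i` may receive: all `S ⊆ X \ {i}`. -/
def bundles (i : Fin n) : Finset (Finset (Fin n)) := (univ.erase i).powerset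

/-- `x i S` is the probability that `i` receives the data of exactly the agents in `S`; the
remaining probability is assigned to the empty set. -/
def IsLottery (x : Fin n → Finset (Fin n) → ℝ) : Prop :=
  (∀ i S, 0 ≤ x i S) ∧ (∀ i S, i ∈ S → x i S = 0) ∧ ∀ i, ∑ S ∈ bundles i, x i S ≤ 1

/-- Expected utility of agent `i`. -/
def utility (E : DataExchange n) (x : Fin n → Finset (Fin n) → ℝ) (i : Fin n) : ℝ :=
  ∑ S ∈ bundles i, E.u i S * x i S

/-- Expected utility that agent `i` receives, summed over the contributors' shares. -/
def received (E : DataExchange n) (x : Fin n → Finset (Fin n) → ℝ) (i : Fin n) : ℝ :=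
  ∑ S ∈ bundles i, ∑ j ∈ S, E.h i j S * x i S

/-- Expected utility that agent `i` contributes to the other agents. -/
def contributed (E : DataExchange n) (x : Fin n → Finset (Fin n) → ℝ) (i : Fin n) : ℝ :=
  ∑ j, ∑ S ∈ (bundles j).filter (fun S => i ∈ S), E.h j i S * x j S

/-- Balance up to an additive error `ε` at every agent. -/
def EpsBalanced (E : DataExchange n) (ε : ℝ) (x : Fin n → Finset (Fin n) → ℝ) : Prop :=
  ∀ i, |E.received x i - E.contributed x i| ≤ ε

/-- A feasible solution: a lottery for every agent, with exact balance. -/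
def Feasible (E : DataExchange n) (x : Fin n → Finset (Fin n) → ℝ) : Prop :=
  IsLottery x ∧ ∀ i, E.received x i = E.contributed x i

/-- A feasible solution in which only the agents of `U` trade, and only among themselves. -/
def FeasibleOn (E : DataExchange n) (U : Finset (Fin n))
    (x : Fin n → Finset (Fin n) → ℝ) : Prop :=
  E.Feasible x ∧ ∀ i S, x i S ≠ 0 → i ∈ U ∧ S ⊆ U

/-- Social welfare. -/
def welfare (E : DataExchange n) (x : Fin n → Finset (Fin n) → ℝ) : ℝ :=
  ∑ i, E.utility x i

/-- `x` has at least a `1 / α` fraction of the largest welfare of an `ε`-balanced solution (hence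
also of the largest welfare of a feasible solution). -/
def IsWelfareApprox (E : DataExchange n) (ε α : ℝ) (x : Fin n → Finset (Fin n) → ℝ) : Prop :=
  ∀ y, IsLottery y → E.EpsBalanced ε y → E.welfare y ≤ α * E.welfare x

/-- `1 / γ`-approximate `c`-stability: no coalition of between `1` and `c` agents has a feasible
solution of its own in which every member gets more than `1 / γ` times the utility it has in `x`.
The inequality is multiplied out, so that `γ = 0` stands for the factor `∞`. -/
def IsApproxStable (E : DataExchange n) (c : ℕ) (γ : ℝ)
    (x : Fin n → Finset (Fin n) → ℝ) : Prop :=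
  ¬ ∃ (U : Finset (Fin n)) (y : Fin n → Finset (Fin n) → ℝ),
    U.Nonempty ∧ U.card ≤ c ∧ E.FeasibleOn U y ∧ ∀ i ∈ U, E.utility x i < γ * E.utility y i

end DataExchange

/-! ### A real random access machine with calls to the utility and share subroutine

Memory consists of two-dimensional arrays of natural numbers and of real numbers, with names in `ℕ`
(a scalar is the entry `(0, 0)` of an array).  Natural numbers serve as indices and counters and
can only be changed by one per operation; real numbers allow exact field operations and comparison,
at unit cost and without rounding or integer parts.  The only constants are natural numbers. -/

namespace RealRAM

/-- Memory contents. -/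
structure Store where
  ints : ℕ → ℕ → ℕ → ℕ
  reals : ℕ → ℕ → ℕ → ℝ

/-- Expressions of index type. -/
inductive IExp where
  | lit (c : ℕ)
  | arr (a : ℕ) (r s : IExp)
  | succ (e : IExp)
  | pred (e : IExp)

/-- Expressions of real type. -/
inductive RExp where
  | ofInt (e : IExp)
  | arr (a : ℕ) (r s : IExp)
  | add (e f : RExp)
  | sub (e f : RExp)
  | mul (e f : RExp)
  | div (e f : RExp)

/-- Tests. -/
inductive Test where
  | ilt (e f : IExp)
  | rle (e f : RExp)
  | neg (b : Test)
  | conj (b c : Test)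

/-- Programs. -/
inductive Cmd where
  | skip
  /-- `a[r, s] := e` for an array of natural numbers -/
  | iset (a : ℕ) (r s : IExp) (e : IExp)
  /-- `a[r, s] := e` for an array of real numbers -/
  | rset (a : ℕ) (r s : IExp) (e : RExp)
  /-- `d[r, s] := u_i(S)`, where `S` is given by row `k` of the array `a` -/
  | callUtility (d : ℕ) (r s : IExp) (i : IExp) (a : ℕ) (k : IExp)
  /-- `d[r, s] := h_{ij}(S)`, where `S` is given by row `k` of the array `a` -/
  | callShare (d : ℕ) (r s : IExp) (i j : IExp) (a : ℕ) (k : IExp)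
  | seq (p q : Cmd)
  | ite (b : Test) (p q : Cmd)
  | loop (b : Test) (p : Cmd)

namespace IExp

def eval (σ : Store) : IExp → ℕ
  | lit c => c
  | arr a r s => σ.ints a (r.eval σ) (s.eval σ)
  | succ e => e.eval σ + 1
  | pred e => e.eval σ - 1

/-- Number of operations performed in an evaluation. -/
def cost : IExp → ℕ
  | lit _ => 1
  | arr _ r s => r.cost + s.cost + 1
  | succ e => e.cost + 1
  | pred e => e.cost + 1

end IExp

namespace RExp

noncomputable def eval (σ : Store) : RExp → ℝ
  | ofInt e => (e.eval σ : ℝ)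
  | arr a r s => σ.reals a (r.eval σ) (s.eval σ)
  | add e f => e.eval σ + f.eval σ
  | sub e f => e.eval σ - f.eval σ
  | mul e f => e.eval σ * f.eval σ
  | div e f => e.eval σ / f.eval σ

/-- Number of operations performed in an evaluation. -/
def cost : RExp → ℕ
  | ofInt e => e.cost + 1
  | arr _ r s => r.cost + s.cost + 1
  | add e f => e.cost + f.cost + 1
  | sub e f => e.cost + f.cost + 1
  | mul e f => e.cost + f.cost + 1
  | div e f => e.cost + f.cost + 1

end RExp

namespace Test

def holds (σ : Store) : Test → Prop
  | ilt e f => e.eval σ < f.eval σ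
  | rle e f => e.eval σ ≤ f.eval σ
  | neg b => ¬ b.holds σ
  | conj b c => b.holds σ ∧ c.holds σ

/-- Number of operations performed in an evaluation. -/
def cost : Test → ℕ
  | ilt e f => e.cost + f.cost + 1
  | rle e f => e.cost + f.cost + 1
  | neg b => b.cost + 1
  | conj b c => b.cost + c.cost + 1

end Test

namespace Store

def setInt (σ : Store) (a r s v : ℕ) : Store where
  ints := fun a' r' s' => if a' = a ∧ r' = r ∧ s' = s then v else σ.ints a' r' s'
  reals := σ.reals

noncomputable def setReal (σ : Store) (a r s : ℕ) (v : ℝ) : Store where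
  ints := σ.ints
  reals := fun a' r' s' => if a' = a ∧ r' = r ∧ s' = s then v else σ.reals a' r' s'

/-- The set of agents whose characteristic vector is row `k` of the array `a`. -/
def rowSet (σ : Store) (n a k : ℕ) : Finset (Fin n) :=
  univ.filter fun j : Fin n => σ.ints a k j ≠ 0

/-- The input: the number of agents `n` and the parameters `ε` and `β`.  The utilities and shares
are available only through calls. -/
noncomputable def init (n : ℕ) (ε β : ℝ) : Store where
  ints := fun a r s => if a = 0 ∧ r = 0 ∧ s = 0 then n else 0
  reals := fun a r s =>
    if a = 0 ∧ r = 0 ∧ s = 0 then ε else if a = 1 ∧ r = 0 ∧ s = 0 then β else 0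

/-- The output: a list of entries `k < ints 1 0 0`, each of which adds the probability
`reals 2 k 0` to the pair of the agent `ints 2 k 0` and the set in row `k` of the array `ints 3`. -/
noncomputable def output (σ : Store) (n : ℕ) (i : Fin n) (S : Finset (Fin n)) : ℝ :=
  ∑ k ∈ range (σ.ints 1 0 0),
    if σ.ints 2 k 0 = i ∧ σ.rowSet n 3 k = S then σ.reals 2 k 0 else 0

end Store

/-- The answer `u_i(S)` to a call (the agent `i` itself is ignored in `S`; zero if there is no
agent `i`). -/
noncomputable def utilityAnswer {n : ℕ} (E : DataExchange n) (i : ℕ) (S : Finset (Fin n)) : ℝ :=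
  if hi : i < n then E.u ⟨i, hi⟩ (S.erase ⟨i, hi⟩) else 0

/-- The answer `h_{ij}(S)` to a call (the agent `i` itself is ignored in `S`; zero if there is no
agent `i`, or if `j` is not in the set). -/
noncomputable def shareAnswer {n : ℕ} (E : DataExchange n) (i j : ℕ) (S : Finset (Fin n)) : ℝ :=
  if hij : i < n ∧ j < n then
    if (⟨j, hij.2⟩ : Fin n) ∈ S.erase ⟨i, hij.1⟩ then
      E.h ⟨i, hij.1⟩ ⟨j, hij.2⟩ (S.erase ⟨i, hij.1⟩)
    else 0
  else 0

/-- `Exec E p σ t τ`: on the instance `E`, the program `p` started in `σ` halts in `τ` after `t`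
steps, where a call has unit cost besides the evaluation of its arguments. -/
inductive Exec {n : ℕ} (E : DataExchange n) : Cmd → Store → ℕ → Store → Prop
  | skip (σ : Store) : Exec E Cmd.skip σ 1 σ
  | iset (σ : Store) (a : ℕ) (r s e : IExp) :
      Exec E (Cmd.iset a r s e) σ (r.cost + s.cost + e.cost + 1)
        (σ.setInt a (r.eval σ) (s.eval σ) (e.eval σ))
  | rset (σ : Store) (a : ℕ) (r s : IExp) (e : RExp) :
      Exec E (Cmd.rset a r s e) σ (r.cost + s.cost + e.cost + 1)
        (σ.setReal a (r.eval σ) (s.eval σ) (e.eval σ))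
  | callUtility (σ : Store) (d : ℕ) (r s i : IExp) (a : ℕ) (k : IExp) :
      Exec E (Cmd.callUtility d r s i a k) σ (r.cost + s.cost + i.cost + k.cost + 1)
        (σ.setReal d (r.eval σ) (s.eval σ)
          (utilityAnswer E (i.eval σ) (σ.rowSet n a (k.eval σ))))
  | callShare (σ : Store) (d : ℕ) (r s i j : IExp) (a : ℕ) (k : IExp) :
      Exec E (Cmd.callShare d r s i j a k) σ
        (r.cost + s.cost + i.cost + j.cost + k.cost + 1)
        (σ.setReal d (r.eval σ) (s.eval σ)
          (shareAnswer E (i.eval σ) (j.eval σ) (σ.rowSet n a (k.eval σ))))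
  | seq {p q : Cmd} {σ τ υ : Store} {t t' : ℕ} :
      Exec E p σ t τ → Exec E q τ t' υ → Exec E (Cmd.seq p q) σ (t + t') υ
  | iteTrue {b : Test} {p q : Cmd} {σ τ : Store} {t : ℕ} :
      b.holds σ → Exec E p σ t τ → Exec E (Cmd.ite b p q) σ (b.cost + t) τ
  | iteFalse {b : Test} {p q : Cmd} {σ τ : Store} {t : ℕ} :
      ¬ b.holds σ → Exec E q σ t τ → Exec E (Cmd.ite b p q) σ (b.cost + t) τ
  | loopTrue {b : Test} {p : Cmd} {σ τ υ : Store} {t t' : ℕ} :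
      b.holds σ → Exec E p σ t τ → Exec E (Cmd.loop b p) τ t' υ →
        Exec E (Cmd.loop b p) σ (b.cost + t + t') υ
  | loopFalse {b : Test} {p : Cmd} {σ : Store} :
      ¬ b.holds σ → Exec E (Cmd.loop b p) σ b.cost σ

end RealRAM

/-! The output is `y + s • X`. The part `y` is exactly balanced, uses probability at most `1 - β`
per agent and gives 2-stability; the part `s • X` uses probability at most `β` and gives the
welfare.

Stability. In a feasible trade between `i` and `j` alone, balance forces what `i` receives to equal
what `j` gains from `i`, so each member gets at most `pairValue i j`, the smaller of their utilities
for each other's data. Agents are matched greedily by this value, and each pair trades at `1 - β`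
times its value. For any `i`, `j`, whichever is matched first already has at least `(1 - β) *
pairValue i j`, so the two cannot both gain enough (`Matching.insert_pair`, `isApproxStable_two`).

Welfare. With prices `π` on the balance constraints, the Lagrangian splits into one problem per
agent: choose `S` to maximize the sum of `(1 + π i - π j) * h i j S` over `j ∈ S`
(`welfare_add_sum_imbalance`). By cross-monotonicity it suffices to look at the buckets, the sets of
agents whose weight exceeds a given power of two: together they account for any `S` up to constants
(`CrossMonotone.weighted_le`). All `K` buckets are proposed at once; this costs a factor `K`, which
is the logarithm in the theorem.

The prices come from multiplicative weights `p`, `m` for the two signs of the imbalances, relative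
to a guess `g` of the optimum. If a proposal is worth less than `g / 8`, weak duality bounds the
optimum by `g`, and `g` is halved (`Progress.failure`). Otherwise the proposal is added to `X` and
the weights are updated (`Progress.success`). The potential `log A` then shows that `W(X) / g` is at
least `t / 16` plus `|imbalance| / (4 * ε)` at every agent (`Progress.final`). Scaling by `β / (t *
K + 4 * W(X) / g)` therefore controls mass and imbalance and keeps welfare of order `β * g / K`
(`output_spec`).

The updates multiply by `1 ± η * b`, so field operations suffice; logarithms occur only in the
analysis. The rest verifies a concrete program in a Hoare-style calculus (`Runs`) that also counts
steps. -/

namespace RealRAM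

variable {n : ℕ}

/-! ### Reasoning about programs -/

namespace Cmd

/-- The integer arrays to which a program writes. -/
def intArrays : Cmd → List ℕ
  | skip => []
  | iset a _ _ _ => [a]
  | rset _ _ _ _ => []
  | callUtility _ _ _ _ _ _ => []
  | callShare _ _ _ _ _ _ _ => []
  | seq p q => p.intArrays ++ q.intArrays
  | ite _ p q => p.intArrays ++ q.intArrays
  | loop _ p => p.intArrays

/-- The real arrays to which a program writes. -/
def realArrays : Cmd → List ℕ
  | skip => []
  | iset _ _ _ _ => []
  | rset a _ _ _ => [a]
  | callUtility d _ _ _ _ _ => [d]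
  | callShare d _ _ _ _ _ _ => [d]
  | seq p q => p.realArrays ++ q.realArrays
  | ite _ p q => p.realArrays ++ q.realArrays
  | loop _ p => p.realArrays

def loopFree : Cmd → Bool
  | seq p q => p.loopFree && q.loopFree
  | ite _ p q => p.loopFree && q.loopFree
  | loop _ _ => false
  | _ => true

/-- An upper bound for the number of steps of a program without loops. -/
def cost : Cmd → ℕ
  | skip => 1
  | iset _ r s e => r.cost + s.cost + e.cost + 1
  | rset _ r s e => r.cost + s.cost + e.cost + 1
  | callUtility _ r s i _ k => r.cost + s.cost + i.cost + k.cost + 1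
  | callShare _ r s i j _ k => r.cost + s.cost + i.cost + j.cost + k.cost + 1
  | seq p q => p.cost + q.cost
  | ite b p q => b.cost + (p.cost + q.cost)
  | loop _ _ => 0

open Classical in
/-- The effect of a program without loops. -/
noncomputable def run (E : DataExchange n) : Cmd → Store → Store
  | skip, σ => σ
  | iset a r s e, σ => σ.setInt a (r.eval σ) (s.eval σ) (e.eval σ)
  | rset a r s e, σ => σ.setReal a (r.eval σ) (s.eval σ) (e.eval σ)
  | callUtility d r s i a k, σ => σ.setReal d (r.eval σ) (s.eval σ)
      (utilityAnswer E (i.eval σ) (σ.rowSet n a (k.eval σ)))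
  | callShare d r s i j a k, σ => σ.setReal d (r.eval σ) (s.eval σ)
      (shareAnswer E (i.eval σ) (j.eval σ) (σ.rowSet n a (k.eval σ)))
  | seq p q, σ => q.run E (p.run E σ)
  | ite b p q, σ => if b.holds σ then p.run E σ else q.run E σ
  | loop _ _, σ => σ

end Cmd

/-- The stores `σ` and `τ` agree outside the integer arrays in `A` and the real arrays in `B`. -/
structure Frame (A B : List ℕ) (σ τ : Store) : Prop where
  ints : ∀ a, a ∉ A → τ.ints a = σ.ints a
  reals : ∀ a, a ∉ B → τ.reals a = σ.reals a

theorem Frame.refl (A B : List ℕ) (σ : Store) : Frame A B σ σ :=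
  ⟨fun _ _ => rfl, fun _ _ => rfl⟩

theorem Frame.trans {A B : List ℕ} {σ τ υ : Store} (h : Frame A B σ τ) (h' : Frame A B τ υ) :
    Frame A B σ υ :=
  ⟨fun a ha => (h'.ints a ha).trans (h.ints a ha),
    fun a ha => (h'.reals a ha).trans (h.reals a ha)⟩

theorem Frame.mono {A B A' B' : List ℕ} {σ τ : Store} (h : Frame A B σ τ) (hA : A ⊆ A')
    (hB : B ⊆ B') : Frame A' B' σ τ :=
  ⟨fun a ha => h.ints a fun h' => ha (hA h'), fun a ha => h.reals a fun h' => ha (hB h')⟩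

theorem Frame.setInt (σ : Store) (a r s v : ℕ) (B : List ℕ) : Frame [a] B σ (σ.setInt a r s v) :=
  ⟨fun a' ha => by
    funext r' s'
    have : a' ≠ a := by simpa using ha
    simp [Store.setInt, this], fun _ _ => rfl⟩

theorem Frame.setReal (σ : Store) (a r s : ℕ) (v : ℝ) (A : List ℕ) :
    Frame A [a] σ (σ.setReal a r s v) :=
  ⟨fun _ _ => rfl, fun a' ha => by
    funext r' s'
    have : a' ≠ a := by simpa using ha
    simp [Store.setReal, this]⟩

/-- The footprint is computed from the syntax, so later side conditions are closed by `decide` and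
invariants need to mention only what changes. -/
theorem Exec.frame {E : DataExchange n} {p : Cmd} {σ τ : Store} {t : ℕ} (h : Exec E p σ t τ) :
    Frame p.intArrays p.realArrays σ τ := by
  induction h with
  | skip σ => exact .refl _ _ _
  | iset => exact .setInt _ _ _ _ _ _
  | rset => exact .setReal _ _ _ _ _ _
  | callUtility => exact .setReal _ _ _ _ _ _
  | callShare => exact .setReal _ _ _ _ _ _
  | seq _ _ ih ih' =>
    exact (ih.mono (by simp [Cmd.intArrays]) (by simp [Cmd.realArrays])).trans
      (ih'.mono (by simp [Cmd.intArrays]) (by simp [Cmd.realArrays]))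
  | iteTrue _ _ ih => exact ih.mono (by simp [Cmd.intArrays]) (by simp [Cmd.realArrays])
  | iteFalse _ _ ih => exact ih.mono (by simp [Cmd.intArrays]) (by simp [Cmd.realArrays])
  | loopTrue _ _ _ ih ih' => exact Frame.trans ih ih'
  | loopFalse _ => exact .refl _ _ _

/-- Started in `σ`, the program `p` halts within `c` steps in a store that satisfies `Q`. -/
def Runs (E : DataExchange n) (p : Cmd) (σ : Store) (c : ℕ) (Q : Store → Prop) : Prop :=
  ∃ t τ, Exec E p σ t τ ∧ t ≤ c ∧ Q τ

namespace Runs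

variable {E : DataExchange n} {p q : Cmd} {σ : Store} {c c' : ℕ} {Q R : Store → Prop}

theorem mono (h : Runs E p σ c Q) (hc : c ≤ c')
    (hQ : ∀ τ, Frame p.intArrays p.realArrays σ τ → Q τ → R τ) : Runs E p σ c' R := by
  obtain ⟨t, τ, h, ht, hQ'⟩ := h
  exact ⟨t, τ, h, ht.trans hc, hQ τ h.frame hQ'⟩

theorem seq (h : Runs E p σ c R)
    (h' : ∀ τ, Frame p.intArrays p.realArrays σ τ → R τ → Runs E q τ c' Q) :
    Runs E (Cmd.seq p q) σ (c + c') Q := by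
  obtain ⟨t, τ, h, ht, hR⟩ := h
  obtain ⟨t', υ, h', ht', hQ⟩ := h' τ h.frame hR
  exact ⟨t + t', υ, h.seq h', by omega, hQ⟩

theorem of_run (hp : p.loopFree = true) (hQ : Q (p.run E σ)) : Runs E p σ p.cost Q := by
  suffices ∀ (p : Cmd) (σ : Store), p.loopFree = true →
      ∃ t, Exec E p σ t (p.run E σ) ∧ t ≤ p.cost by
    obtain ⟨t, h, ht⟩ := this p σ hp
    exact ⟨t, _, h, ht, hQ⟩
  clear hp hQ
  intro p
  induction p with
  | skip => exact fun σ _ => ⟨_, .skip σ, le_rfl⟩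
  | iset a r s e => exact fun σ _ => ⟨_, .iset σ a r s e, le_rfl⟩
  | rset a r s e => exact fun σ _ => ⟨_, .rset σ a r s e, le_rfl⟩
  | callUtility d r s i a k => exact fun σ _ => ⟨_, .callUtility σ d r s i a k, le_rfl⟩
  | callShare d r s i j a k => exact fun σ _ => ⟨_, .callShare σ d r s i j a k, le_rfl⟩
  | seq p q ihp ihq =>
    intro σ h
    simp only [Cmd.loopFree, Bool.and_eq_true] at h
    obtain ⟨t, hp, ht⟩ := ihp σ h.1
    obtain ⟨t', hq, ht'⟩ := ihq (p.run E σ) h.2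
    exact ⟨t + t', hp.seq hq, add_le_add ht ht'⟩
  | ite b p q ihp ihq =>
    intro σ h
    simp only [Cmd.loopFree, Bool.and_eq_true] at h
    obtain ⟨t, hp, ht⟩ := ihp σ h.1
    obtain ⟨t', hq, ht'⟩ := ihq σ h.2
    by_cases hb : b.holds σ
    · exact ⟨b.cost + t, by simpa [Cmd.run, hb] using Exec.iteTrue hb hp, by
        simp only [Cmd.cost]; omega⟩
    · exact ⟨b.cost + t', by simpa [Cmd.run, hb] using Exec.iteFalse hb hq, by
        simp only [Cmd.cost]; omega⟩
  | loop b p => exact fun σ h => absurd h (by simp [Cmd.loopFree])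

theorem ite {b : Test} (hp : b.holds σ → Runs E p σ c Q) (hq : ¬ b.holds σ → Runs E q σ c Q) :
    Runs E (Cmd.ite b p q) σ (b.cost + c) Q := by
  by_cases hb : b.holds σ
  · obtain ⟨t, τ, h, ht, hQ⟩ := hp hb
    exact ⟨_, τ, .iteTrue hb h, by omega, hQ⟩
  · obtain ⟨t, τ, h, ht, hQ⟩ := hq hb
    exact ⟨_, τ, .iteFalse hb h, by omega, hQ⟩

/-- A loop with invariant `I`, where `I m` can hold at the start of an iteration only if
`m < M`. -/
theorem loop {b : Test} {M l : ℕ} {I : ℕ → Store → Prop} (h0 : I l σ)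
    (hM : ∀ m τ, Frame p.intArrays p.realArrays σ τ → I m τ → b.holds τ → m < M)
    (hs : ∀ m τ, Frame p.intArrays p.realArrays σ τ → I m τ → b.holds τ →
      Runs E p τ c (I (m + 1)))
    (hQ : ∀ m τ, Frame p.intArrays p.realArrays σ τ → I m τ → ¬ b.holds τ → Q τ) :
    Runs E (Cmd.loop b p) σ ((M - l) * (c + b.cost) + b.cost) Q := by
  -- Induction on a bound for the number of iterations left; when it is zero, `hM` forces the test
  -- to fail.
  suffices ∀ d m τ, M - m ≤ d → Frame p.intArrays p.realArrays σ τ → I m τ →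
      Runs E (Cmd.loop b p) τ (d * (c + b.cost) + b.cost) Q from
    this _ l σ le_rfl (.refl _ _ _) h0
  intro d
  induction d with
  | zero =>
    intro m τ hd hF hI
    have hb : ¬ b.holds τ := fun hb => by have := hM m τ hF hI hb; omega
    exact ⟨_, τ, .loopFalse hb, by simp, hQ m τ hF hI hb⟩
  | succ d ih =>
    intro m τ hd hF hI
    by_cases hb : b.holds τ
    · obtain ⟨t, υ, h, ht, hI'⟩ := hs m τ hF hI hb
      have := hM m τ hF hI hb
      obtain ⟨t', ρ, h', ht', hQ'⟩ := ih (m + 1) υ (by omega) (hF.trans h.frame) hI'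
      refine ⟨_, ρ, .loopTrue hb h h', ?_, hQ'⟩
      rw [Nat.succ_mul]
      omega
    · exact ⟨_, τ, .loopFalse hb, by omega, hQ m τ hF hI hb⟩

end Runs

/-- The entry `(0, 0)` of an integer array, as an expression. -/
abbrev iscal (a : ℕ) : IExp := .arr a (.lit 0) (.lit 0)

/-- The entry `(0, 0)` of a real array, as an expression. -/
abbrev rscal (a : ℕ) : RExp := .arr a (.lit 0) (.lit 0)

/-- The entry `(e, 0)` of a real array, as an expression. -/
abbrev rvec (a : ℕ) (e : IExp) : RExp := .arr a e (.lit 0)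

/-- A natural number as a real constant. -/
abbrev rlit (c : ℕ) : RExp := .ofInt (.lit c)

abbrev setScalI (a : ℕ) (e : IExp) : Cmd := .iset a (.lit 0) (.lit 0) e

abbrev setScalR (a : ℕ) (e : RExp) : Cmd := .rset a (.lit 0) (.lit 0) e

abbrev setVecR (a : ℕ) (r : IExp) (e : RExp) : Cmd := .rset a r (.lit 0) e

/-- `for v = lo, …, b - 1 do p`, where `v` and `b` are scalars. -/
def Cmd.for (v : ℕ) (lo : IExp) (b : ℕ) (p : Cmd) : Cmd :=
  .seq (setScalI v lo) (.loop (.ilt (iscal v) (iscal b))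
    (.seq p (setScalI v (.succ (iscal v)))))

/-- The counter is incremented after the body, so `hI` asks that the invariant not depend on it.
Each iteration adds 7 steps for the test and 7 for the increment. -/
theorem Runs.for {E : DataExchange n} {v b l N c : ℕ} {lo : IExp} {p : Cmd} {σ : Store}
    {Q : Store → Prop} (I : ℕ → Store → Prop) (hv : v ∉ p.intArrays) (hb : b ∉ p.intArrays)
    (hvb : b ≠ v) (hlo : lo.eval σ = l) (hN : σ.ints b 0 0 = N) (hl : l ≤ N)
    (hI : ∀ k τ x, I k τ → I k (τ.setInt v 0 0 x)) (h0 : I l σ)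
    (hs : ∀ k τ, Frame (v :: p.intArrays) p.realArrays σ τ → l ≤ k → k < N →
      τ.ints v 0 0 = k → I k τ → Runs E p τ c (I (k + 1)))
    (hQ : ∀ τ, Frame (v :: p.intArrays) p.realArrays σ τ → I N τ → Q τ) :
    Runs E (Cmd.for v lo b p) σ (lo.cost + 10 + (N - l) * (c + 14)) Q := by
  have key : Runs E (Cmd.for v lo b p) σ
      (lo.cost + 3 + ((N - l) * (c + 7 + 7) + 7)) Q := by
    refine Runs.seq (c := lo.cost + 3)
      (R := fun τ => τ = σ.setInt v 0 0 l) ?_ ?_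
    · refine (Runs.of_run (Q := fun τ => τ = σ.setInt v 0 0 l) rfl ?_).mono ?_ fun _ _ h => h
      · simp [Cmd.run, IExp.eval, hlo]
      · simp [Cmd.cost, IExp.cost]; omega
    rintro τ hF rfl
    have hFσ : Frame (v :: p.intArrays) p.realArrays σ (σ.setInt v 0 0 l) :=
      (Frame.setInt σ v 0 0 l p.realArrays).mono (by simp) (List.Subset.refl _)
    have hsub : (Cmd.seq p (setScalI v (.succ (iscal v)))).intArrays ⊆ v :: p.intArrays := by
      simp [Cmd.intArrays]
    have hsub' : (Cmd.seq p (setScalI v (.succ (iscal v)))).realArrays ⊆ p.realArrays := by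
      simp [Cmd.realArrays]
    refine Runs.loop (l := l) (M := N) (b := .ilt (iscal v) (iscal b))
      (I := fun k τ => τ.ints v 0 0 = k ∧ l ≤ k ∧ k ≤ N ∧ τ.ints b 0 0 = N ∧ I k τ)
      ?_ ?_ ?_ ?_
    · refine ⟨by simp [Store.setInt], le_rfl, hl, ?_, hI _ _ _ h0⟩
      simp [Store.setInt, hvb, hN]
    · rintro m τ - ⟨h1, -, -, h2, -⟩ h
      simpa [Test.holds, IExp.eval, h1, h2] using h
    · rintro m τ hFτ ⟨h1, h2, h3, h4, h5⟩ h
      have hm : m < N := by simpa [Test.holds, IExp.eval, h1, h4] using h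
      refine Runs.seq (hs m τ (hFσ.trans (hFτ.mono hsub hsub')) h2 hm h1 h5) ?_
      intro υ hFυ hυ
      have e1 := hFυ.ints v hv
      have e2 := hFυ.ints b hb
      refine (Runs.of_run (Q := fun ρ => ρ = υ.setInt v 0 0 (m + 1)) rfl ?_).mono ?_ ?_
      · simp [Cmd.run, IExp.eval, e1, h1]
      · simp [Cmd.cost, IExp.cost]
      · rintro ρ - rfl
        refine ⟨by simp [Store.setInt], by omega, by omega, ?_, hI _ _ _ hυ⟩
        simp [Store.setInt, hvb, e2, h4]
    · rintro m τ hFτ ⟨h1, h2, h3, h4, h5⟩ h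
      have hm : m = N := by
        have : ¬ m < N := by simpa [Test.holds, IExp.eval, h1, h4] using h
        omega
      subst hm
      exact hQ τ (hFσ.trans (hFτ.mono hsub hsub')) h5
  exact key.mono (by ring_nf; omega) fun _ _ h => h

end RealRAM

namespace DataExchange

variable {n : ℕ} {E : DataExchange n}

/-! ### Shares, linearity and weights -/

theorem mem_bundles {i : Fin n} {S : Finset (Fin n)} : S ∈ bundles i ↔ i ∉ S := by
  rw [bundles, mem_powerset, subset_erase]
  exact ⟨fun h => h.2, fun h => ⟨subset_univ _, h⟩⟩

/-- Removing `j` does not lower the other shares, so these sum to at most `u i (S.erase j) ≤ u i S`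
already in `S`; what is left for `j` is nonnegative. -/
theorem CrossMonotone.share_nonneg (hE : E.CrossMonotone) {i j : Fin n} {S : Finset (Fin n)}
    (hi : i ∉ S) (hj : j ∈ S) : 0 ≤ E.h i j S := by
  have h1 := E.sum_share i S hi
  have h2 := E.sum_share i (S.erase j) fun h => hi (mem_of_mem_erase h)
  have h3 := E.u_mono i S (S.erase j) hi (erase_subset _ _)
  have h4 : ∑ k ∈ S.erase j, E.h i k S ≤ ∑ k ∈ S.erase j, E.h i k (S.erase j) :=
    sum_le_sum fun k hk => hE i S _ k hi (erase_subset _ _) hk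
  have h5 := add_sum_erase S (fun k => E.h i k S) hj
  linarith

theorem share_singleton (E : DataExchange n) {i j : Fin n} (h : i ≠ j) :
    E.h i j {j} = E.u i {j} := by
  simpa using E.sum_share i {j} (by simpa using h)

theorem received_eq_utility (E : DataExchange n) (x : Fin n → Finset (Fin n) → ℝ) (i : Fin n) :
    E.received x i = E.utility x i := by
  refine sum_congr rfl fun S hS => ?_
  rw [← sum_mul, E.sum_share i S (mem_bundles.1 hS)]

/-- Expected utility as a linear map. -/
def utilityHom (E : DataExchange n) (i : Fin n) : (Fin n → Finset (Fin n) → ℝ) →ₗ[ℝ] ℝ where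
  toFun x := E.utility x i
  map_add' x y := by simp [utility, mul_add, sum_add_distrib]
  map_smul' c x := by simp [utility, mul_sum, mul_left_comm]

/-- Social welfare as a linear map. -/
def welfareHom (E : DataExchange n) : (Fin n → Finset (Fin n) → ℝ) →ₗ[ℝ] ℝ :=
  ∑ i, E.utilityHom i

theorem welfareHom_apply (E : DataExchange n) (x : Fin n → Finset (Fin n) → ℝ) :
    E.welfareHom x = E.welfare x := by
  simp only [welfareHom, LinearMap.sum_apply]
  rfl

/-- Contributed utility as a linear map. -/
def contributedHom (E : DataExchange n) (i : Fin n) :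
    (Fin n → Finset (Fin n) → ℝ) →ₗ[ℝ] ℝ where
  toFun x := E.contributed x i
  map_add' x y := by simp [contributed, mul_add, sum_add_distrib]
  map_smul' c x := by simp [contributed, mul_sum, mul_left_comm]

/-- Received minus contributed utility as a linear map. -/
def imbalance (E : DataExchange n) (i : Fin n) : (Fin n → Finset (Fin n) → ℝ) →ₗ[ℝ] ℝ :=
  E.utilityHom i - E.contributedHom i

theorem imbalance_apply (E : DataExchange n) (i : Fin n) (x : Fin n → Finset (Fin n) → ℝ) :
    E.imbalance i x = E.received x i - E.contributed x i := by
  rw [received_eq_utility]; rfl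

/-- One unit of probability for agent `i` and the set `S`. -/
def atom (i : ℕ) (S : Finset (Fin n)) : Fin n → Finset (Fin n) → ℝ :=
  fun i' S' => if i = i' ∧ S = S' then 1 else 0

theorem utilityHom_atom (E : DataExchange n) {i : Fin n} {S : Finset (Fin n)} (hi : i ∉ S)
    (j : Fin n) : E.utilityHom j (atom i S) = if i = j then E.u i S else 0 := by
  change ∑ T ∈ bundles j, E.u j T * (if (i : ℕ) = j ∧ S = T then 1 else 0) = _
  by_cases h : i = j
  · subst h
    simp [mem_bundles, hi]
  · simp [h, Fin.val_inj]

theorem welfareHom_atom (E : DataExchange n) {i : Fin n} {S : Finset (Fin n)} (hi : i ∉ S) :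
    E.welfareHom (atom i S) = E.u i S := by
  simp [welfareHom, utilityHom_atom E hi]

theorem contributedHom_atom (E : DataExchange n) {i : Fin n} {S : Finset (Fin n)} (hi : i ∉ S)
    (j : Fin n) : E.contributedHom j (atom i S) = if j ∈ S then E.h i j S else 0 := by
  change ∑ k, ∑ T ∈ (bundles k).filter (fun S => j ∈ S),
    E.h k j T * (if (i : ℕ) = k ∧ S = T then 1 else 0) = _
  rw [sum_eq_single i]
  · simp [mem_bundles, hi, sum_ite_eq]
  · intro k _ hk
    simp [Fin.val_inj, hk.symm]
  · simp

theorem imbalance_atom (E : DataExchange n) {i : Fin n} {S : Finset (Fin n)} (hi : i ∉ S)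
    (j : Fin n) : E.imbalance j (atom i S) =
      (if i = j then E.u i S else 0) - if j ∈ S then E.h i j S else 0 := by
  rw [imbalance, LinearMap.sub_apply, utilityHom_atom E hi, contributedHom_atom E hi]

/-- Welfare plus weighted imbalances, written as a sum of weighted shares. -/
theorem welfare_add_sum_imbalance (E : DataExchange n) (π : Fin n → ℝ)
    (x : Fin n → Finset (Fin n) → ℝ) :
    E.welfare x + ∑ i, π i * E.imbalance i x =
      ∑ i, ∑ S ∈ bundles i, x i S * ∑ j ∈ S, (1 + π i - π j) * E.h i j S := by
  have h1 : E.welfare x + ∑ i, π i * E.utility x i =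
      ∑ i, ∑ S ∈ bundles i, x i S * ∑ j ∈ S, (1 + π i) * E.h i j S := by
    rw [welfare, ← sum_add_distrib]
    refine sum_congr rfl fun i _ => ?_
    rw [utility, mul_sum, ← sum_add_distrib]
    refine sum_congr rfl fun S hS => ?_
    rw [← mul_sum, E.sum_share i S (mem_bundles.1 hS)]
    ring
  -- Double counting: contributions are regrouped by receiver instead of contributor.
  have h2 : ∑ i, π i * E.contributed x i =
      ∑ i, ∑ S ∈ bundles i, x i S * ∑ j ∈ S, π j * E.h i j S := by
    simp only [contributed, mul_sum, sum_filter]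
    rw [sum_comm]
    refine sum_congr rfl fun i _ => ?_
    rw [sum_comm]
    refine sum_congr rfl fun S _ => ?_
    simp only [mul_ite, mul_zero]
    rw [← sum_filter]
    simp only [filter_univ_mem]
    exact sum_congr rfl fun j _ => by ring
  have h3 : ∀ i, π i * E.imbalance i x = π i * E.utility x i - π i * E.contributed x i :=
    fun i => by rw [imbalance_apply, received_eq_utility]; ring
  simp only [h3, sum_sub_distrib]
  rw [← add_sub_assoc, h1, h2, ← sum_sub_distrib]
  refine sum_congr rfl fun i _ => ?_
  rw [← sum_sub_distrib]
  refine sum_congr rfl fun S _ => ?_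
  rw [← mul_sub, ← sum_sub_distrib]
  congr 1
  exact sum_congr rfl fun j _ => by ring

theorem welfare_atom_add_sum_imbalance (E : DataExchange n) (π : Fin n → ℝ) {i : Fin n}
    {S : Finset (Fin n)} (hi : i ∉ S) :
    E.welfareHom (atom i S) + ∑ k, π k * E.imbalance k (atom i S) =
      ∑ j ∈ S, (1 + π i - π j) * E.h i j S := by
  rw [welfareHom_apply, welfare_add_sum_imbalance, sum_eq_single i]
  · simp [atom, mem_bundles, hi]
  · intro k _ hk
    simp [atom, Fin.val_inj, hk.symm]
  · simp

theorem utility_nonneg (E : DataExchange n) {x : Fin n → Finset (Fin n) → ℝ}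
    (hx : ∀ i S, 0 ≤ x i S) (i : Fin n) : 0 ≤ E.utility x i :=
  sum_nonneg fun S hS => mul_nonneg (E.u_nonneg i S (mem_bundles.1 hS)) (hx i S)

theorem utility_le (E : DataExchange n) {x : Fin n → Finset (Fin n) → ℝ}
    (hx : ∀ i S, 0 ≤ x i S) (i : Fin n) : E.utility x i ≤ ∑ S ∈ bundles i, x i S :=
  sum_le_sum fun S hS =>
    mul_le_of_le_one_left (hx i S) (E.u_le_one i S (mem_bundles.1 hS))

theorem welfare_nonneg (E : DataExchange n) {x : Fin n → Finset (Fin n) → ℝ}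
    (hx : ∀ i S, 0 ≤ x i S) : 0 ≤ E.welfare x :=
  sum_nonneg fun i _ => E.utility_nonneg hx i

theorem IsLottery.welfare_le {x : Fin n → Finset (Fin n) → ℝ} (hx : IsLottery x) :
    E.welfare x ≤ n := by
  calc E.welfare x ≤ ∑ _i : Fin n, (1 : ℝ) :=
        sum_le_sum fun i _ => (E.utility_le hx.1 i).trans (hx.2.2 i)
    _ = n := by simp

theorem CrossMonotone.contributed_nonneg (hE : E.CrossMonotone)
    {x : Fin n → Finset (Fin n) → ℝ} (hx : ∀ i S, 0 ≤ x i S) (i : Fin n) :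
    0 ≤ E.contributed x i := by
  refine sum_nonneg fun j _ => sum_nonneg fun S hS => ?_
  rw [mem_filter, mem_bundles] at hS
  exact mul_nonneg (hE.share_nonneg hS.1 hS.2) (hx j S)

theorem CrossMonotone.contributed_le (hE : E.CrossMonotone)
    {x : Fin n → Finset (Fin n) → ℝ} (hx : ∀ i S, 0 ≤ x i S) (i : Fin n) :
    E.contributed x i ≤ E.welfare x := by
  refine sum_le_sum fun j _ => ?_
  rw [utility, sum_filter]
  refine sum_le_sum fun S hS => ?_
  have hj := mem_bundles.1 hS
  split_ifs with h
  · refine mul_le_mul_of_nonneg_right ?_ (hx j S)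
    rw [← E.sum_share j S hj]
    exact single_le_sum (f := fun k => E.h j k S) (fun k hk => hE.share_nonneg hj hk) h
  · exact mul_nonneg (E.u_nonneg j S hj) (hx j S)

/-- Received and contributed utility both lie between `0` and the welfare. This gives the width
bound for the weight updates. -/
theorem CrossMonotone.abs_imbalance_le (hE : E.CrossMonotone)
    {x : Fin n → Finset (Fin n) → ℝ} (hx : ∀ i S, 0 ≤ x i S) (i : Fin n) :
    |E.imbalance i x| ≤ E.welfare x := by
  rw [imbalance_apply, received_eq_utility]
  have h1 := hE.contributed_nonneg hx i
  have h2 := hE.contributed_le hx i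
  have h3 := E.utility_nonneg hx i
  have h4 : E.utility x i ≤ E.welfare x :=
    single_le_sum (f := fun i => E.utility x i) (fun j _ => E.utility_nonneg hx j) (mem_univ i)
  rw [abs_le]
  constructor <;> linarith

/-- A lottery in which one agent gets all data with probability `ε`. -/
theorem Normalized.exists_lottery (hN : E.Normalized) (hE : E.CrossMonotone) {ε : ℝ} (h0 : 0 < ε)
    (h1 : ε < 1) : ∃ y, IsLottery y ∧ E.EpsBalanced ε y ∧ E.welfare y = ε := by
  obtain ⟨i, hi⟩ := hN
  have hy : ∀ j S, 0 ≤ (ε • atom (i : ℕ) (univ.erase i)) j S := fun j S => by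
    simp only [Pi.smul_apply, atom, smul_eq_mul]
    positivity
  have hW : E.welfare (ε • atom (i : ℕ) (univ.erase i)) = ε := by
    rw [← welfareHom_apply, map_smul, welfareHom_atom E (by simp), hi]; simp
  refine ⟨ε • atom (i : ℕ) (univ.erase i), ⟨hy, ?_, ?_⟩, ?_, hW⟩
  · intro j S hj
    simp only [Pi.smul_apply, atom, smul_eq_mul, mul_ite, mul_one, mul_zero]
    refine if_neg fun h => ?_
    have := Fin.val_injective h.1
    subst this
    rw [← h.2] at hj
    simp at hj
  · intro j
    simp only [Pi.smul_apply, atom, smul_eq_mul, mul_ite, mul_one, mul_zero]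
    by_cases h : (i : ℕ) = j
    · simp only [h, true_and, sum_ite_eq]
      split_ifs <;> linarith
    · simp [h]
  · intro j
    rw [← imbalance_apply]
    exact (hE.abs_imbalance_le hy j).trans hW.le

/-! ### Buckets of weights -/

/-- If `1 / 2 ≤ w`, the largest threshold not exceeding `w` is more than `w / 2`, so twice that
threshold suffices; all smaller `w`, negative ones included, are covered by the constant. -/
theorem le_sum_thresholds {w : ℝ} (K : ℕ) (hw : w < 2 ^ K / 2) :
    w ≤ 1 / 2 + ∑ k ∈ range K, if (2 : ℝ) ^ k / 2 ≤ w then 2 * (2 ^ k / 2) else 0 := by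
  induction K with
  | zero => simp at hw ⊢; linarith
  | succ K ih =>
    rw [sum_range_succ]
    by_cases h : w < 2 ^ K / 2
    · have := ih h
      rw [if_neg (not_le.2 h)]
      linarith
    · rw [if_pos (not_lt.1 h)]
      have : 0 ≤ ∑ k ∈ range K, if (2 : ℝ) ^ k / 2 ≤ w then 2 * ((2 : ℝ) ^ k / 2) else 0 :=
        sum_nonneg fun k _ => by split_ifs <;> positivity
      rw [pow_succ] at hw
      linarith

/-- The agents `j ≠ i` with weight at least `2 ^ k / 2`, given the prices `π`. -/
noncomputable def bucket (π : Fin n → ℝ) (i : Fin n) (k : ℕ) : Finset (Fin n) :=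
  (univ.filter fun j => (2 : ℝ) ^ k / 2 ≤ 1 + π i - π j).erase i

theorem notMem_bucket (π : Fin n → ℝ) (i : Fin n) (k : ℕ) : i ∉ bucket π i k := by
  simp [bucket]

/-- All bundles proposed at the prices `π`. -/
noncomputable def proposal (K : ℕ) (π : Fin n → ℝ) : Fin n → Finset (Fin n) → ℝ :=
  ∑ i : Fin n, ∑ k ∈ range K, atom (i : ℕ) (bucket π i k)

/-- A lower bound for the value of the proposed bundles at the prices `π`. -/
noncomputable def proposalValue (E : DataExchange n) (K : ℕ) (π : Fin n → ℝ) : ℝ :=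
  ∑ i : Fin n, ∑ k ∈ range K, 2 ^ k / 2 * E.u i (bucket π i k)

/-- For a fixed threshold, discarding the agents of `S` below it only raises the shares of the
others, which then sum to the utility of a subset of the bucket. The remainder `u i S / 2` is later
absorbed by half of the welfare. -/
theorem CrossMonotone.weighted_le (hE : E.CrossMonotone) {π : Fin n → ℝ} {K : ℕ} {i : Fin n}
    (hπ : ∀ j, 1 + π i - π j < 2 ^ K / 2) {S : Finset (Fin n)} (hi : i ∉ S) :
    ∑ j ∈ S, (1 + π i - π j) * E.h i j S ≤
      E.u i S / 2 + 2 * ∑ k ∈ range K, 2 ^ k / 2 * E.u i (bucket π i k) := by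
  have h1 : ∑ j ∈ S, (1 + π i - π j) * E.h i j S ≤
      ∑ j ∈ S, (1 / 2 + ∑ k ∈ range K,
        if (2 : ℝ) ^ k / 2 ≤ 1 + π i - π j then 2 * (2 ^ k / 2) else 0) * E.h i j S :=
    sum_le_sum fun j hj =>
      mul_le_mul_of_nonneg_right (le_sum_thresholds K (hπ j)) (hE.share_nonneg hi hj)
  refine h1.trans ?_
  simp only [add_mul, sum_add_distrib]
  rw [← mul_sum, E.sum_share i S hi]
  simp only [sum_mul]
  rw [sum_comm, mul_sum]
  have h2 : ∀ k ∈ range K, ∑ j ∈ S,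
      (if (2 : ℝ) ^ k / 2 ≤ 1 + π i - π j then 2 * ((2 : ℝ) ^ k / 2) else 0) * E.h i j S ≤
      2 * (2 ^ k / 2 * E.u i (bucket π i k)) := by
    intro k _
    simp only [ite_mul, zero_mul]
    rw [← sum_filter, ← mul_sum, mul_assoc]
    refine mul_le_mul_of_nonneg_left (mul_le_mul_of_nonneg_left ?_ (by positivity)) zero_le_two
    have hsub : (S.filter fun j => (2 : ℝ) ^ k / 2 ≤ 1 + π i - π j) ⊆ bucket π i k := by
      intro j hj
      rw [mem_filter] at hj
      rw [bucket, mem_erase, mem_filter]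
      exact ⟨fun h => hi (h ▸ hj.1), mem_univ _, hj.2⟩
    have hi' : i ∉ S.filter fun j => (2 : ℝ) ^ k / 2 ≤ 1 + π i - π j :=
      fun h => hi (mem_filter.1 h).1
    calc _ ≤ ∑ j ∈ S.filter fun j => (2 : ℝ) ^ k / 2 ≤ 1 + π i - π j,
          E.h i j (S.filter fun j => (2 : ℝ) ^ k / 2 ≤ 1 + π i - π j) :=
          sum_le_sum fun j hj => hE i S _ j hi (filter_subset _ _) hj
      _ = _ := E.sum_share i _ hi'
      _ ≤ _ := E.u_mono i _ _ (notMem_bucket π i k) hsub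
  have h3 := sum_le_sum h2
  linarith

/-- If the proposed bundles have a small value, then so does every lottery. -/
theorem CrossMonotone.welfare_le_of_proposalValue_lt (hE : E.CrossMonotone) {π : Fin n → ℝ}
    {K : ℕ} {g ε : ℝ} (hε : 0 < ε) (hπ : ∑ i, |π i| ≤ g / (4 * ε))
    (hw : ∀ i j, 1 + π i - π j < 2 ^ K / 2) (hV : E.proposalValue K π < g / 8)
    {y : Fin n → Finset (Fin n) → ℝ} (hy : IsLottery y) (hb : E.EpsBalanced ε y) :
    E.welfare y ≤ g := by
  have h1 := E.welfare_add_sum_imbalance π y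
  have h2 : ∑ i, ∑ S ∈ bundles i, y i S * ∑ j ∈ S, (1 + π i - π j) * E.h i j S ≤
      E.welfare y / 2 + 2 * E.proposalValue K π := by
    rw [welfare, proposalValue, sum_div, mul_sum, ← sum_add_distrib]
    refine sum_le_sum fun i _ => ?_
    have hc : 0 ≤ ∑ k ∈ range K, (2 : ℝ) ^ k / 2 * E.u i (bucket π i k) :=
      sum_nonneg fun k _ => mul_nonneg (by positivity) (E.u_nonneg _ _ (notMem_bucket π i k))
    calc ∑ S ∈ bundles i, y i S * ∑ j ∈ S, (1 + π i - π j) * E.h i j S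
        ≤ ∑ S ∈ bundles i, y i S *
          (E.u i S / 2 + 2 * ∑ k ∈ range K, 2 ^ k / 2 * E.u i (bucket π i k)) :=
          sum_le_sum fun S hS => mul_le_mul_of_nonneg_left
            (hE.weighted_le (hw i) (mem_bundles.1 hS)) (hy.1 i S)
      _ = E.utility y i / 2 + (∑ S ∈ bundles i, y i S) *
          (2 * ∑ k ∈ range K, 2 ^ k / 2 * E.u i (bucket π i k)) := by
          rw [utility, sum_div, sum_mul, ← sum_add_distrib]
          exact sum_congr rfl fun S _ => by ring
      _ ≤ _ := by
          have := mul_le_of_le_one_left (mul_nonneg zero_le_two hc) (hy.2.2 i)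
          linarith
  -- Total price at most `g / (4 * ε)` against imbalances at most `ε`. With `h1` and `h2` this gives
  -- `W - g / 4 ≤ W / 2 + 2 * V`, where `V < g / 8`.
  have h3 : -(g / 4) ≤ ∑ i, π i * E.imbalance i y := by
    have : |∑ i, π i * E.imbalance i y| ≤ g / 4 := by
      calc |∑ i, π i * E.imbalance i y| ≤ ∑ i, |π i * E.imbalance i y| := abs_sum_le_sum_abs _ _
        _ ≤ ∑ i, |π i| * ε := sum_le_sum fun i _ => by
            rw [abs_mul, imbalance_apply]
            exact mul_le_mul_of_nonneg_left (hb i) (abs_nonneg _)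
        _ = (∑ i, |π i|) * ε := (sum_mul _ _ _).symm
        _ ≤ g / (4 * ε) * ε := mul_le_mul_of_nonneg_right hπ hε.le
        _ = g / 4 := by field_simp
    exact (abs_le.1 this).1
  linarith

/-- Every member of a bucket has weight at least the threshold, and the shares are nonnegative with
sum the utility. -/
theorem CrossMonotone.proposalValue_le (hE : E.CrossMonotone) (K : ℕ) (π : Fin n → ℝ) :
    E.proposalValue K π ≤
      E.welfareHom (proposal K π) + ∑ i, π i * E.imbalance i (proposal K π) := by
  have h : E.welfareHom (proposal K π) + ∑ i, π i * E.imbalance i (proposal K π) =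
      ∑ i : Fin n, ∑ k ∈ range K, ∑ j ∈ bucket π i k,
        (1 + π i - π j) * E.h i j (bucket π i k) := by
    simp only [← welfare_atom_add_sum_imbalance E π (notMem_bucket π _ _)]
    simp only [proposal, map_sum, mul_sum, sum_add_distrib]
    congr 1
    rw [sum_comm]
    exact sum_congr rfl fun i _ => sum_comm
  rw [h, proposalValue]
  refine sum_le_sum fun i _ => sum_le_sum fun k _ => ?_
  have hi := notMem_bucket π i k
  rw [← E.sum_share i _ hi, mul_sum]
  refine sum_le_sum fun j hj => mul_le_mul_of_nonneg_right ?_ (hE.share_nonneg hi hj)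
  exact (mem_filter.1 (mem_of_mem_erase hj)).2

/-! ### Mass and width of the proposal -/

theorem atom_nonneg (i : ℕ) (S : Finset (Fin n)) (j : Fin n) (T : Finset (Fin n)) :
    0 ≤ atom i S j T := by
  unfold atom; positivity

theorem atom_of_mem {i : Fin n} {S : Finset (Fin n)} (hi : i ∉ S) {j : Fin n}
    {T : Finset (Fin n)} (hj : j ∈ T) : atom (i : ℕ) S j T = 0 := by
  refine if_neg fun h => ?_
  rw [Fin.val_inj] at h
  rw [h.1, h.2] at hi
  exact hi hj

theorem sum_atom {i : Fin n} {S : Finset (Fin n)} (hi : i ∉ S) (j : Fin n) :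
    ∑ T ∈ bundles j, atom (i : ℕ) S j T = if i = j then 1 else 0 := by
  unfold atom
  by_cases h : i = j
  · subst h; simp [mem_bundles, hi]
  · simp [h, Fin.val_inj]

theorem proposal_nonneg (K : ℕ) (π : Fin n → ℝ) (j : Fin n) (T : Finset (Fin n)) :
    0 ≤ proposal K π j T := by
  simp only [proposal, Finset.sum_apply]
  exact sum_nonneg fun i _ => sum_nonneg fun k _ => atom_nonneg _ _ _ _

theorem proposal_of_mem (K : ℕ) (π : Fin n → ℝ) {j : Fin n} {T : Finset (Fin n)} (h : j ∈ T) :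
    proposal K π j T = 0 := by
  simp only [proposal, Finset.sum_apply]
  exact sum_eq_zero fun i _ => sum_eq_zero fun k _ => atom_of_mem (notMem_bucket π i k) h

theorem sum_proposal (K : ℕ) (π : Fin n → ℝ) (j : Fin n) :
    ∑ T ∈ bundles j, proposal K π j T = K := by
  simp only [proposal, Finset.sum_apply]
  rw [sum_comm]
  have : ∀ i : Fin n, ∑ T ∈ bundles j, ∑ k ∈ range K, atom (i : ℕ) (bucket π i k) j T =
      if i = j then (K : ℝ) else 0 := by
    intro i
    rw [sum_comm]
    simp only [sum_atom (notMem_bucket π i _)]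
    split_ifs <;> simp
  simp [this]

theorem CrossMonotone.abs_imbalance_proposal_le (hE : E.CrossMonotone) (K : ℕ) (π : Fin n → ℝ)
    (i : Fin n) : |E.imbalance i (proposal K π)| ≤ n * K := by
  refine (hE.abs_imbalance_le (proposal_nonneg K π) i).trans ?_
  calc E.welfare (proposal K π) ≤ ∑ _j : Fin n, (K : ℝ) :=
        sum_le_sum fun j _ => (E.utility_le (proposal_nonneg K π) j).trans (sum_proposal K π j).le
    _ = n * K := by simp

/-! ### Multiplicative weights -/

/-- The step size of the multiplicative updates. -/
noncomputable def stepSize (n K : ℕ) (ε : ℝ) : ℝ := ε / (16 * ((n * K) * (n * K)))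

/-- The price of agent `i`, given the weights `p` and `m` for positive and negative imbalances. -/
noncomputable def price (ε g A : ℝ) (p m : Fin n → ℝ) (i : Fin n) : ℝ :=
  g / (4 * ε) * ((m i - p i) / A)

/-- The state after `t` rounds with the guess `g` for the optimal welfare: `X` is the sum of the
bundles proposed so far, and `A` the sum of the weights `p` and `m`. -/
structure Progress (E : DataExchange n) (ε : ℝ) (K t : ℕ) (g A : ℝ) (p m : Fin n → ℝ)
    (X : Fin n → Finset (Fin n) → ℝ) : Prop where
  g_pos : 0 < g
  g_le : g ≤ n
  -- The factor 2 is the slack lost when a guess that is still an upper bound is halved.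
  opt_le : ∀ y, IsLottery y → E.EpsBalanced ε y → E.welfare y ≤ 2 * g
  p_pos : ∀ i, 0 < p i
  m_pos : ∀ i, 0 < m i
  sum_eq : A = ∑ i, (p i + m i)
  X_nonneg : ∀ i S, 0 ≤ X i S
  X_of_mem : ∀ i S, i ∈ S → X i S = 0
  X_mass : ∀ i, ∑ S ∈ bundles i, X i S = t * K
  -- The weight is a product of factors `1 + η * b`, each with logarithm at least `η * b - 2 * (η *
  -- (n * K)) ^ 2`.
  log_p : ∀ i, stepSize n K ε * E.imbalance i X - t * (2 * (stepSize n K ε * (n * K)) ^ 2) ≤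
    Real.log (p i)
  log_m : ∀ i, -(stepSize n K ε * E.imbalance i X) - t * (2 * (stepSize n K ε * (n * K)) ^ 2) ≤
    Real.log (m i)
  -- The potential starts at `log (2 * n)`; its growth is paid for by welfare.
  le_welfare : t / 8 + (Real.log A - Real.log (2 * n)) / (4 * ε * stepSize n K ε) ≤
    E.welfareHom X / g

/-- From `log x ≥ 1 - 1 / x` the claim reduces to `0 ≤ z ^ 2 * (1 + 2 * z)`. -/
theorem sub_two_sq_le_log_one_add {z : ℝ} (hz : |z| ≤ 1 / 2) :
    z - 2 * z ^ 2 ≤ Real.log (1 + z) := by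
  have h := abs_le.1 hz
  have h1 : 0 < 1 + z := by linarith
  refine le_trans ?_ (Real.one_sub_inv_le_log_of_pos h1)
  rw [le_sub_iff_add_le, ← le_sub_iff_add_le', inv_le_iff_one_le_mul₀ h1]
  nlinarith [mul_nonneg (by linarith : 0 ≤ 1 + 2 * z) (sq_nonneg z)]

namespace Progress

variable {ε g A : ℝ} {K t : ℕ} {p m : Fin n → ℝ} {X : Fin n → Finset (Fin n) → ℝ}

theorem init (hn : 2 ≤ n) :
    Progress E ε K 0 n (n + n) (fun _ => 1) (fun _ => 1) 0 where
  g_pos := by positivity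
  g_le := le_rfl
  opt_le y hy _ := hy.welfare_le.trans (by linarith [Nat.cast_nonneg (α := ℝ) n])
  p_pos _ := one_pos
  m_pos _ := one_pos
  sum_eq := by simp
  X_nonneg _ _ := le_rfl
  X_of_mem _ _ _ := rfl
  X_mass _ := by simp
  log_p _ := by simp
  log_m _ := by simp
  le_welfare := by simp [two_mul]

variable (P : Progress E ε K t g A p m X)
include P

theorem A_pos (hn : 2 ≤ n) : 0 < A := by
  have : Nonempty (Fin n) := ⟨⟨0, by omega⟩⟩
  rw [P.sum_eq]
  exact sum_pos (fun i _ => add_pos (P.p_pos i) (P.m_pos i)) univ_nonempty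

theorem sum_abs_price_le (hn : 2 ≤ n) (hε : 0 < ε) :
    ∑ i, |price ε g A p m i| ≤ g / (4 * ε) := by
  have hA := P.A_pos hn
  have hg := P.g_pos
  have h : ∀ i, |price ε g A p m i| ≤ g / (4 * ε) * ((p i + m i) / A) := by
    intro i
    rw [price, abs_mul, abs_div (m i - p i), abs_of_pos hA,
      abs_of_pos (by positivity : 0 < g / (4 * ε))]
    gcongr
    have := P.p_pos i
    have := P.m_pos i
    rw [abs_le]; constructor <;> linarith
  refine (sum_le_sum fun i _ => h i).trans ?_
  rw [← mul_sum, ← sum_div, ← P.sum_eq, div_self hA.ne', mul_one]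

/-- Prices are at most `n / (4 * ε)` in absolute value, so weights are at most `1 + n / (2 * ε) ≤ n
/ ε`: the `K` thresholds reach every weight that can occur. -/
theorem weight_lt (hn : 2 ≤ n) (hε : 0 < ε) (hε1 : ε < 1) (hK : (n : ℝ) / ε < 2 ^ K / 2)
    (i j : Fin n) : 1 + price ε g A p m i - price ε g A p m j < 2 ^ K / 2 := by
  have h := P.sum_abs_price_le hn hε
  have h1 : ∀ i, |price ε g A p m i| ≤ g / (4 * ε) := fun i =>
    (single_le_sum (f := fun i => |price ε g A p m i|) (fun _ _ => abs_nonneg _)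
      (mem_univ i)).trans h
  have hi := (abs_le.1 (h1 i)).2
  have hj := (abs_le.1 (h1 j)).1
  have hg : g / (4 * ε) ≤ n / ε / 4 := by
    rw [div_div, mul_comm ε]
    exact div_le_div_of_nonneg_right P.g_le (by positivity)
  have hn' : (2 : ℝ) ≤ n := by exact_mod_cast hn
  have h2 : 2 ≤ n / ε := by
    rw [le_div_iff₀ hε]; linarith
  linarith

/-- A round in which the guess is confirmed. -/
theorem success (hE : E.CrossMonotone) (hn : 2 ≤ n) (hε : 0 < ε) (hε1 : ε < 1) (hK0 : 1 ≤ K)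
    (hV : g / 8 ≤ E.proposalValue K (price ε g A p m)) {b p' m' : Fin n → ℝ} {A' : ℝ}
    (hb : ∀ i, b i = E.imbalance i (proposal K (price ε g A p m)))
    (hp : ∀ i, p' i = p i * (1 + stepSize n K ε * b i))
    (hm : ∀ i, m' i = m i * (1 - stepSize n K ε * b i))
    (hA : A' = A + ∑ i, stepSize n K ε * ((p i - m i) * b i)) :
    Progress E ε K (t + 1) g A' p' m' (X + proposal K (price ε g A p m)) := by
  have hA0 := P.A_pos hn
  have hg := P.g_pos
  have hn0 : (0 : ℝ) < n := by positivity
  have hK' : (0 : ℝ) < K := by positivity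
  have hnK : (1 : ℝ) ≤ n * K := by
    have : 1 ≤ n * K := Nat.one_le_iff_ne_zero.2 (by positivity)
    exact_mod_cast this
  set η := stepSize n K ε with hη
  have hη0 : 0 < η := by rw [hη, stepSize]; positivity
  have hηK : η * (n * K) ≤ 1 / 2 := by
    rw [hη, stepSize, div_mul_eq_mul_div, div_le_iff₀ (by positivity)]
    nlinarith
  have hbK : ∀ i, |η * b i| ≤ η * (n * K) := fun i => by
    rw [abs_mul, abs_of_pos hη0, hb]
    exact mul_le_mul_of_nonneg_left (hE.abs_imbalance_proposal_le K _ i) hη0.le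
  have hsq : ∀ i, (η * b i) ^ 2 ≤ (η * (n * K)) ^ 2 := fun i =>
    sq_le_sq' (by linarith [(abs_le.1 (hbK i)).1]) (abs_le.1 (hbK i)).2
  have hlog : ∀ i, η * b i - 2 * (η * (n * K)) ^ 2 ≤ Real.log (1 + η * b i) := fun i => by
    have := sub_two_sq_le_log_one_add ((hbK i).trans hηK)
    linarith [hsq i]
  have hlog' : ∀ i, -(η * b i) - 2 * (η * (n * K)) ^ 2 ≤ Real.log (1 - η * b i) := fun i => by
    have := sub_two_sq_le_log_one_add (z := -(η * b i)) (by rw [abs_neg]; exact (hbK i).trans hηK)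
    rw [← sub_eq_add_neg, neg_sq] at this
    linarith [hsq i]
  have hpos : ∀ i, 0 < 1 + η * b i := fun i => by linarith [(abs_le.1 ((hbK i).trans hηK)).1]
  have hpos' : ∀ i, 0 < 1 - η * b i := fun i => by linarith [(abs_le.1 ((hbK i).trans hηK)).2]
  have hp0 : ∀ i, 0 < p' i := fun i => by rw [hp]; exact mul_pos (P.p_pos i) (hpos i)
  have hm0 : ∀ i, 0 < m' i := fun i => by rw [hm]; exact mul_pos (P.m_pos i) (hpos' i)
  have hsum : A' = ∑ i, (p' i + m' i) := by
    rw [hA, P.sum_eq, ← sum_add_distrib]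
    exact sum_congr rfl fun i _ => by rw [hp, hm]; ring
  refine ⟨hg, P.g_le, P.opt_le, hp0, hm0, hsum, ?_, ?_, ?_, ?_, ?_, ?_⟩
  · exact fun i S => add_nonneg (P.X_nonneg i S) (proposal_nonneg K _ i S)
  · exact fun i S h => by
      simp only [Pi.add_apply, P.X_of_mem i S h, proposal_of_mem K _ h, add_zero]
  · intro i
    simp only [Pi.add_apply, sum_add_distrib, P.X_mass i, sum_proposal]
    push_cast; ring
  · intro i
    have h1 := P.log_p i
    have h2 := hlog i
    rw [hp, Real.log_mul (P.p_pos i).ne' (hpos i).ne', map_add, ← hb]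
    push_cast
    linarith
  · intro i
    have h1 := P.log_m i
    have h2 := hlog' i
    rw [hm, Real.log_mul (P.m_pos i).ne' (hpos' i).ne', map_add, ← hb]
    push_cast
    linarith
  -- `Q` is the average imbalance under the weights. The potential grows by at most `η * Q`, and the
  -- price term of the proposal is `-(g / (4 * ε)) * Q`, so a large growth forces a large welfare.
  · set Q := (∑ i, (p i - m i) * b i) / A with hQ
    have hA' : A' = A * (1 + η * Q) := by
      rw [hA, ← mul_sum, hQ]; field_simp
    have hA'0 : 0 < A' := by
      have : Nonempty (Fin n) := ⟨⟨0, by omega⟩⟩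
      rw [hsum]
      exact sum_pos (fun i _ => add_pos (hp0 i) (hm0 i)) univ_nonempty
    have hQ0 : 0 < 1 + η * Q := by
      rw [hA'] at hA'0
      exact pos_of_mul_pos_right hA'0 hA0.le
    have hlogA : Real.log A' ≤ Real.log A + η * Q := by
      rw [hA', Real.log_mul hA0.ne' hQ0.ne']
      linarith [Real.log_le_sub_one_of_pos hQ0]
    have hprice : ∑ i, price ε g A p m i * E.imbalance i (proposal K (price ε g A p m)) =
        -(g / (4 * ε) * Q) := by
      rw [hQ, sum_div, mul_sum, ← sum_neg_distrib]
      refine sum_congr rfl fun i _ => ?_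
      rw [← hb, price]; ring
    have hv := hV.trans (hE.proposalValue_le K _)
    rw [hprice] at hv
    have h1 : 1 / 8 + Q / (4 * ε) ≤ E.welfareHom (proposal K (price ε g A p m)) / g := by
      rw [le_div_iff₀ hg]
      have : (1 / 8 + Q / (4 * ε)) * g = g / 8 + g / (4 * ε) * Q := by ring
      linarith
    have h2 : (Real.log A' - Real.log (2 * n)) / (4 * ε * η) ≤
        (Real.log A - Real.log (2 * n)) / (4 * ε * η) + Q / (4 * ε) := by
      have : Q / (4 * ε) = η * Q / (4 * ε * η) := by field_simp
      rw [this, ← add_div]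
      exact div_le_div_of_nonneg_right (by linarith) (by positivity)
    have h3 := P.le_welfare
    rw [map_add, add_div]
    push_cast
    linarith

/-- A round in which the guess is halved. -/
theorem failure (hE : E.CrossMonotone) (hn : 2 ≤ n) (hε : 0 < ε) (hε1 : ε < 1)
    (hK : (n : ℝ) / ε < 2 ^ K / 2) (hV : E.proposalValue K (price ε g A p m) < g / 8) :
    Progress E ε K t (g / 2) A p m X := by
  have hg := P.g_pos
  refine { P with
    g_pos := half_pos hg
    g_le := (half_le_self hg.le).trans P.g_le
    opt_le := ?_
    le_welfare := P.le_welfare.trans ?_ }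
  · intro y hy hb
    have := hE.welfare_le_of_proposalValue_lt hε (P.sum_abs_price_le hn hε)
      (P.weight_lt hn hε hε1 hK) hV hy hb
    linarith
  -- Halving `g` only increases `W(X) / g`, so weights and accepted bundles survive the change of
  -- guess.
  · refine div_le_div_of_nonneg_left ?_ (half_pos hg) (half_le_self hg.le)
    rw [welfareHom_apply]
    exact E.welfare_nonneg P.X_nonneg

/-- The optimum is at least `ε`, which limits the number of halvings. -/
theorem le_guess (hE : E.CrossMonotone) (hN : E.Normalized) (hε : 0 < ε) (hε1 : ε < 1) :
    ε ≤ 2 * g := by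
  obtain ⟨y, hy, hb, hW⟩ := hN.exists_lottery hE hε hε1
  exact hW ▸ P.opt_le y hy hb

/-- After sufficiently many rounds, the welfare outweighs the imbalances. -/
theorem final (hn : 2 ≤ n) (hε : 0 < ε) (hK0 : 1 ≤ K)
    (ht : 256 * (n : ℝ) * ((n * K) * (n * K)) ≤ t * ε * ε) (i : Fin n) :
    t / 16 + |E.imbalance i X| / (4 * ε) ≤ E.welfareHom X / g := by
  have hA := P.A_pos hn
  have hn0 : (0 : ℝ) < n := by positivity
  have hK' : (0 : ℝ) < K := by positivity
  have hw := P.le_welfare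
  have hlp := P.log_p i
  have hlm := P.log_m i
  set η := stepSize n K ε with hη
  have hη0 : 0 < η := by rw [hη, stepSize]; positivity
  have hle : ∀ i, p i + m i ≤ A := fun i => by
    rw [P.sum_eq]
    exact single_le_sum (f := fun i => p i + m i)
      (fun j _ => (add_pos (P.p_pos j) (P.m_pos j)).le) (mem_univ i)
  have h1 : Real.log (p i) ≤ Real.log A :=
    Real.log_le_log (P.p_pos i) (by linarith [hle i, P.m_pos i])
  have h2 : Real.log (m i) ≤ Real.log A :=
    Real.log_le_log (P.m_pos i) (by linarith [hle i, P.p_pos i])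
  have h3 : η * |E.imbalance i X| - t * (2 * (η * (n * K)) ^ 2) ≤ Real.log A := by
    rcases abs_cases (E.imbalance i X) with h | h <;> rw [h.1] <;> linarith
  -- A crude bound, so that the stopping test can be computed without logarithms; it costs only more
  -- rounds.
  have h4 : Real.log (2 * n) ≤ 2 * n := (Real.log_le_sub_one_of_pos (by positivity)).trans
    (by linarith)
  have h5 : (η * |E.imbalance i X| - t * (2 * (η * (n * K)) ^ 2) - 2 * n) / (4 * ε * η) ≤
      (Real.log A - Real.log (2 * n)) / (4 * ε * η) :=
    div_le_div_of_nonneg_right (by linarith) (by positivity)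
  -- By the choice of `stepSize` the quadratic error is exactly `t / 32`; by `ht` the initial
  -- potential costs at most another `t / 32`. Of `t / 8` there remains `t / 16`.
  have h6 : (η * |E.imbalance i X| - t * (2 * (η * (n * K)) ^ 2) - 2 * n) / (4 * ε * η) =
      |E.imbalance i X| / (4 * ε) - t / 32 - 8 * n * ((n * K) * (n * K)) / (ε * ε) := by
    rw [hη, stepSize]
    field_simp
    ring
  have h7 : 8 * n * ((n * K) * (n * K)) / (ε * ε) ≤ (t : ℝ) / 32 := by
    rw [div_le_iff₀ (by positivity)]
    linarith
  linarith

end Progress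

/-! ### Trades between two agents -/

/-- The utility of agent `i` for the data of agent `j` alone. -/
def pairUtility (E : DataExchange n) (i j : Fin n) : ℝ := E.u i (({j} : Finset (Fin n)).erase i)

/-- The utility that both `i` and `j` can get by trading with each other. -/
def pairValue (E : DataExchange n) (i j : Fin n) : ℝ := min (E.pairUtility i j) (E.pairUtility j i)

theorem pairUtility_self (E : DataExchange n) (i : Fin n) : E.pairUtility i i = 0 := by
  simp [pairUtility, E.u_empty]

theorem pairUtility_of_ne (E : DataExchange n) {i j : Fin n} (h : i ≠ j) :
    E.pairUtility i j = E.u i {j} := by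
  rw [pairUtility, erase_eq_of_notMem (by simpa using h)]

theorem pairUtility_nonneg (E : DataExchange n) (i j : Fin n) : 0 ≤ E.pairUtility i j :=
  E.u_nonneg _ _ (by simp)

theorem pairValue_self (E : DataExchange n) (i : Fin n) : E.pairValue i i = 0 := by
  simp [pairValue, pairUtility_self]

theorem pairValue_comm (E : DataExchange n) (i j : Fin n) : E.pairValue i j = E.pairValue j i :=
  min_comm _ _

theorem pairValue_nonneg (E : DataExchange n) (i j : Fin n) : 0 ≤ E.pairValue i j :=
  le_min (E.pairUtility_nonneg i j) (E.pairUtility_nonneg j i)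

/-- The trades `y` between the agents of `D`, who are matched greedily and trade with
probability at most `γ`. -/
structure Matching (E : DataExchange n) (γ : ℝ) (D : Finset (Fin n))
    (y : Fin n → Finset (Fin n) → ℝ) : Prop where
  nonneg : ∀ i S, 0 ≤ y i S
  of_mem : ∀ i S, i ∈ S → y i S = 0
  mass : ∀ i, ∑ S ∈ bundles i, y i S ≤ if i ∈ D then γ else 0
  balanced : ∀ i, E.imbalance i y = 0
  stable : ∀ i ∈ D, ∀ j, γ * E.pairValue i j ≤ max (E.utilityHom i y) (E.utilityHom j y)

theorem Matching.empty (E : DataExchange n) (γ : ℝ) : Matching E γ ∅ 0 where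
  nonneg _ _ := le_rfl
  of_mem _ _ _ := rfl
  mass _ := by simp
  balanced _ := map_zero _
  stable i hi := by simp at hi

/-- The exchange between `a` and `b`, scaled by `γ`. -/
noncomputable def swap (E : DataExchange n) (γ : ℝ) (a b : Fin n) : Fin n → Finset (Fin n) → ℝ :=
  -- The probabilities are chosen so that both agents receive exactly `γ * pairValue a b`; the one
  -- with the smaller utility receives with probability `γ`.
  (γ * E.pairValue a b / E.pairUtility a b) • atom (a : ℕ) {b} +
    (γ * E.pairValue a b / E.pairUtility b a) • atom (b : ℕ) {a}

/-- The new pair is disjoint from `D`, so masses do not accumulate. For stability, a pair that meets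
`D` was settled before, and a pair outside `D` has value at most that of `a`, `b` by the greedy
choice. -/
theorem Matching.insert_pair {γ : ℝ} {D : Finset (Fin n)} {y : Fin n → Finset (Fin n) → ℝ}
    (M : Matching E γ D y) (hγ : 0 ≤ γ) {a b : Fin n} (ha : a ∉ D) (hb : b ∉ D)
    (hab : 0 < E.pairValue a b)
    (hmax : ∀ i j, i ∉ D → j ∉ D → E.pairValue i j ≤ E.pairValue a b) :
    Matching E γ (insert a (insert b D)) (y + E.swap γ a b) := by
  have hne : a ≠ b := by
    rintro rfl
    rw [pairValue_self] at hab
    exact hab.false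
  have hab' : a ∉ ({b} : Finset (Fin n)) := by simpa using hne
  have hba' : b ∉ ({a} : Finset (Fin n)) := by simpa using hne.symm
  have h1 : 0 < E.pairUtility a b := hab.trans_le (min_le_left _ _)
  have h2 : 0 < E.pairUtility b a := hab.trans_le (min_le_right _ _)
  have hutil : ∀ i, E.utilityHom i (E.swap γ a b) =
      if i = a ∨ i = b then γ * E.pairValue a b else 0 := by
    intro i
    rw [swap, map_add, map_smul, map_smul, utilityHom_atom E hab', utilityHom_atom E hba',
      ← pairUtility_of_ne E hne, ← pairUtility_of_ne E hne.symm]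
    by_cases hia : i = a
    · subst hia
      simp only [if_true, hne.symm, if_false, true_or, smul_eq_mul, mul_zero, add_zero]
      field_simp
    · by_cases hib : i = b
      · subst hib
        simp only [if_true, hne, if_false, or_true, smul_eq_mul, mul_zero, zero_add]
        field_simp
      · simp [hia, hib, Ne.symm hia, Ne.symm hib]
  have hnn : ∀ i S, 0 ≤ E.swap γ a b i S := fun i S => by
    simp only [swap, Pi.add_apply, Pi.smul_apply, smul_eq_mul]
    have := atom_nonneg a {b} i S
    have := atom_nonneg b {a} i S
    have := hab.le
    positivity
  have hmono : ∀ i, E.utilityHom i y ≤ E.utilityHom i (y + E.swap γ a b) := fun i => by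
    rw [map_add]
    exact le_add_of_nonneg_right (E.utility_nonneg hnn i)
  refine ⟨fun i S => add_nonneg (M.nonneg i S) (hnn i S), ?_, ?_, ?_, ?_⟩
  · intro i S h
    simp only [Pi.add_apply, swap, Pi.smul_apply, smul_eq_mul, M.of_mem i S h,
      atom_of_mem hab' h, atom_of_mem hba' h, mul_zero, add_zero]
  · intro i
    have hM := M.mass i
    have hca : γ * E.pairValue a b / E.pairUtility a b ≤ γ := by
      rw [div_le_iff₀ h1]
      exact mul_le_mul_of_nonneg_left (min_le_left _ _) hγ
    have hcb : γ * E.pairValue a b / E.pairUtility b a ≤ γ := by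
      rw [div_le_iff₀ h2]
      exact mul_le_mul_of_nonneg_left (min_le_right _ _) hγ
    simp only [Pi.add_apply, swap, Pi.smul_apply, smul_eq_mul, sum_add_distrib, ← mul_sum,
      sum_atom hab', sum_atom hba']
    by_cases hia : i = a
    · subst hia
      rw [if_neg ha] at hM
      simp only [if_true, hne.symm, if_false, mem_insert, true_or]
      linarith
    · by_cases hib : i = b
      · subst hib
        rw [if_neg hb] at hM
        simp only [if_true, hne, if_false, mem_insert, true_or, or_true]
        linarith
      · simpa [hia, hib, Ne.symm hia, Ne.symm hib] using hM
  · intro i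
    rw [map_add, M.balanced, zero_add, imbalance, LinearMap.sub_apply, hutil, swap, map_add,
      map_smul, map_smul, contributedHom_atom E hab', contributedHom_atom E hba']
    by_cases hia : i = a
    · subst hia
      simp only [mem_singleton, if_true, hne, if_false, true_or, smul_eq_mul, mul_zero, zero_add,
        share_singleton E hne.symm, ← pairUtility_of_ne E hne.symm]
      field_simp
      simp
    · by_cases hib : i = b
      · subst hib
        simp only [mem_singleton, if_true, hne.symm, if_false, or_true, smul_eq_mul, mul_zero,
          add_zero, share_singleton E hne, ← pairUtility_of_ne E hne]
        field_simp
        simp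
      · simp [hia, hib]
  · intro i hi j
    by_cases h : i ∈ D
    · exact (M.stable i h j).trans (max_le_max (hmono i) (hmono j))
    by_cases h' : j ∈ D
    · rw [pairValue_comm, max_comm]
      exact (M.stable j h' i).trans (max_le_max (hmono j) (hmono i))
    have hi' : i = a ∨ i = b := by
      rw [mem_insert, mem_insert] at hi
      tauto
    refine le_trans ?_ (le_max_left _ _)
    rw [map_add, hutil, if_pos hi']
    have := mul_le_mul_of_nonneg_left (hmax i j h h') hγ
    have := E.utility_nonneg M.nonneg i
    have : 0 ≤ E.utilityHom i y := this
    linarith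

/-- Members of a coalition of two agents can get at most the value of their trade. -/
theorem FeasibleOn.utility_le_pairValue {i j : Fin n} {y : Fin n → Finset (Fin n) → ℝ}
    (hy : E.FeasibleOn {i, j} y) : E.utility y i ≤ E.pairValue i j := by
  obtain ⟨⟨hl, hb⟩, hs⟩ := hy
  have hone : ∀ a b : Fin n, y a {b} ≤ 1 := by
    intro a b
    by_cases h : a = b
    · rw [hl.2.1 a {b} (by simp [h])]; exact zero_le_one
    · exact (single_le_sum (f := fun S => y a S) (fun S _ => hl.1 a S)
        (mem_bundles.2 (by simpa using h))).trans (hl.2.2 a)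
  have hsub : ∀ S : Finset (Fin n), S ⊆ {i, j} → i ∉ S → S = ∅ ∨ S = {j} := by
    intro S hS hi
    rw [← subset_singleton_iff]
    intro k hk
    have := hS hk
    rw [mem_insert, mem_singleton] at this
    rcases this with rfl | rfl
    · exact absurd hk hi
    · simp
  have hu : E.utility y i ≤ E.pairUtility i j := by
    by_cases h : i = j
    · subst h
      rw [pairUtility_self, utility]
      refine (sum_eq_zero fun S hS => ?_).le
      by_cases h0 : y i S = 0
      · simp [h0]
      · rcases hsub S (hs i S h0).2 (mem_bundles.1 hS) with rfl | rfl
        · simp [E.u_empty]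
        · simp [mem_bundles] at hS
    · rw [pairUtility_of_ne E h, utility, sum_eq_single {j}]
      · exact mul_le_of_le_one_right (E.u_nonneg _ _ (by simpa using h)) (hone i j)
      · intro S hS hSj
        by_cases h0 : y i S = 0
        · simp [h0]
        · rcases hsub S (hs i S h0).2 (mem_bundles.1 hS) with rfl | rfl
          · simp [E.u_empty]
          · exact absurd rfl hSj
      · intro h'
        exact absurd (mem_bundles.2 (by simpa using h)) h'
  refine le_min hu ?_
  by_cases h : i = j
  · subst h; exact hu
  -- By balance, `i` receives what it contributes, and its only possible receiver is `j`, through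
  -- the bundle `{i}`.
  rw [← received_eq_utility, hb i, contributed, sum_eq_single j, sum_eq_single {i}]
  · rw [share_singleton E (Ne.symm h), ← pairUtility_of_ne E (Ne.symm h)]
    exact mul_le_of_le_one_right (E.pairUtility_nonneg j i) (hone j i)
  · intro S hS hSi
    rw [mem_filter, mem_bundles] at hS
    by_cases h0 : y j S = 0
    · simp [h0]
    · exfalso
      apply hSi
      ext k
      rw [mem_singleton]
      refine ⟨fun hk => ?_, fun hk => hk ▸ hS.2⟩
      have := (hs j S h0).2 hk
      rw [mem_insert, mem_singleton] at this
      rcases this with rfl | rfl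
      · rfl
      · exact absurd hk hS.1
  · intro h'
    refine absurd ?_ h'
    simpa [mem_bundles] using Ne.symm h
  · intro k _ hk
    refine sum_eq_zero fun S hS => ?_
    rw [mem_filter, mem_bundles] at hS
    by_cases h0 : y k S = 0
    · simp [h0]
    · exfalso
      have := (hs k S h0).1
      rw [mem_insert, mem_singleton] at this
      rcases this with rfl | rfl
      · exact hS.1 hS.2
      · exact hk rfl
  · simp

theorem isApproxStable_two {γ : ℝ} {x : Fin n → Finset (Fin n) → ℝ} (hγ : 0 ≤ γ)
    (h : ∀ i j, γ * E.pairValue i j ≤ max (E.utility x i) (E.utility x j)) :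
    E.IsApproxStable 2 γ x := by
  rintro ⟨U, y, ⟨i, hi⟩, hcard, hy, hlt⟩
  -- A single agent is treated as the pair `{i, i}`, whose `pairValue` is zero.
  obtain ⟨j, rfl⟩ : ∃ j, U = {i, j} := by
    rcases Nat.lt_or_ge 1 U.card with h1 | h1
    · obtain ⟨a, b, -, hU⟩ := card_eq_two.1 (le_antisymm hcard h1)
      rw [hU, mem_insert, mem_singleton] at hi
      rcases hi with rfl | rfl
      · exact ⟨b, hU⟩
      · exact ⟨a, hU.trans (pair_comm _ _)⟩
    · obtain ⟨a, hU⟩ := card_eq_one.1 (le_antisymm h1 (card_pos.2 ⟨i, hi⟩))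
      rw [hU, mem_singleton] at hi
      subst hi
      exact ⟨i, by simpa using hU⟩
  have h1 := hlt i (by simp)
  have h2 := hlt j (by simp)
  have h3 := mul_le_mul_of_nonneg_left hy.utility_le_pairValue hγ
  have h4 := mul_le_mul_of_nonneg_left
    ((pair_comm i j ▸ hy : E.FeasibleOn {j, i} y).utility_le_pairValue) hγ
  rw [pairValue_comm] at h4
  rcases le_max_iff.1 (h i j) with h5 | h5 <;> linarith

/-! ### Combination of the two parts -/

/-- With `z` the maximum, `n / ε ≤ z ^ 2` and `4 ≤ z ^ 2`, hence `2 ^ K ≤ z ^ 4`. -/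
theorem bucket_count_le {K : ℕ} {ε : ℝ} (hn : 2 ≤ n) (hε : 0 < ε)
    (hK : (2 : ℝ) ^ K ≤ 4 * (n / ε)) :
    (K : ℝ) ≤ 4 / Real.log 2 * Real.log (max (n : ℝ) (1 / ε)) := by
  have hn' : (2 : ℝ) ≤ n := by exact_mod_cast hn
  set z := max (n : ℝ) (1 / ε) with hz
  have h1 : (n : ℝ) ≤ z := le_max_left _ _
  have h2 : 1 / ε ≤ z := le_max_right _ _
  have hz0 : 0 < z := by linarith
  have hl2 : 0 < Real.log 2 := Real.log_pos one_lt_two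
  have h3 : (2 : ℝ) ^ K ≤ z ^ 4 := by
    refine hK.trans ?_
    have h4 : n / ε ≤ z * z := by
      rw [div_eq_mul_one_div]
      exact mul_le_mul h1 h2 (by positivity) hz0.le
    have h5 : (4 : ℝ) ≤ z * z := by nlinarith
    calc 4 * (n / ε) ≤ (z * z) * (z * z) := by gcongr
      _ = z ^ 4 := by ring
  have h4 := Real.log_le_log (by positivity) h3
  rw [Real.log_pow, Real.log_pow] at h4
  rw [div_mul_eq_mul_div, le_div_iff₀ hl2]
  exact_mod_cast h4

/-- In the denominator, `t * K` caps the mass of the scaled `X` at `β` and `4 * R` caps its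
imbalances at `ε`. Since `t ≤ 16 * R`, the denominator is at most `20 * K * R`, so the welfare is at
least `β * g / (20 * K)` while the optimum is at most `2 * g`. The constant is `160 = 2 * 20 * 4`,
the 4 coming from `bucket_count_le`. -/
theorem output_spec (hn : 2 ≤ n) {ε β g A : ℝ} {K t : ℕ}
    {p m : Fin n → ℝ} {X y : Fin n → Finset (Fin n) → ℝ} {D : Finset (Fin n)}
    (hε : 0 < ε) (hβ : 0 < β) (hβ1 : β ≤ 1)
    (P : Progress E ε K t g A p m X) (hK0 : 1 ≤ K) (hK : (2 : ℝ) ^ K ≤ 4 * (n / ε))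
    (ht : 256 * (n : ℝ) * ((n * K) * (n * K)) ≤ t * ε * ε)
    (M : Matching E (1 - β) D y) (hD : ∀ i j, i ∉ D → j ∉ D → E.pairValue i j = 0)
    {x : Fin n → Finset (Fin n) → ℝ}
    (hx : x = y + (β / (t * K + 4 * (E.welfareHom X / g))) • X) :
    IsLottery x ∧ E.EpsBalanced ε x ∧
      E.IsWelfareApprox ε (160 / Real.log 2 * Real.log (max (n : ℝ) (1 / ε)) / β) x ∧
      E.IsApproxStable 2 (1 - β) x := by
  have hg := P.g_pos
  have hn0 : (0 : ℝ) < n := by positivity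
  have hK' : (0 : ℝ) < K := by positivity
  have ht0 : (0 : ℝ) < t := by
    by_contra h
    have h' : (t : ℝ) = 0 := le_antisymm (not_lt.1 h) (Nat.cast_nonneg t)
    rw [h', zero_mul, zero_mul] at ht
    exact absurd ht (not_le.2 (by positivity))
  have hfin := P.final hn hε hK0 ht
  set R := E.welfareHom X / g with hR
  have hR0 : t / 16 ≤ R := by
    have := hfin ⟨0, by omega⟩
    have h' : 0 ≤ |E.imbalance (⟨0, by omega⟩ : Fin n) X| / (4 * ε) := by positivity
    linarith
  have hRpos : 0 < R := lt_of_lt_of_le (by positivity) hR0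
  set s := β / (t * K + 4 * R) with hs
  have hden : 0 < t * K + 4 * R := by positivity
  have hs0 : 0 < s := by positivity
  have hsK : s * (t * K) ≤ β := by
    rw [hs, div_mul_eq_mul_div, div_le_iff₀ hden]
    nlinarith
  have hsR : s * (4 * R) ≤ β := by
    have : 0 ≤ (t : ℝ) * K := by positivity
    rw [hs, div_mul_eq_mul_div, div_le_iff₀ hden]
    nlinarith
  have hγ : 0 ≤ 1 - β := sub_nonneg.2 hβ1
  have hXnn : ∀ i S, 0 ≤ (s • X) i S := fun i S => mul_nonneg hs0.le (P.X_nonneg i S)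
  have hxnn : ∀ i S, 0 ≤ x i S := fun i S => by
    rw [hx]; exact add_nonneg (M.nonneg i S) (hXnn i S)
  refine ⟨⟨hxnn, ?_, ?_⟩, ?_, ?_, ?_⟩
  · intro i S h
    simp only [hx, Pi.add_apply, Pi.smul_apply, M.of_mem i S h, P.X_of_mem i S h, smul_zero,
      add_zero]
  · intro i
    simp only [hx, Pi.add_apply, Pi.smul_apply, smul_eq_mul, sum_add_distrib, ← mul_sum,
      P.X_mass i]
    have := M.mass i
    split_ifs at this <;> linarith
  · intro i
    rw [← imbalance_apply, hx, map_add, map_smul, M.balanced, zero_add, smul_eq_mul, abs_mul,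
      abs_of_pos hs0]
    have h1 : |E.imbalance i X| ≤ 4 * R * ε := by
      have := hfin i
      have h2 : |E.imbalance i X| / (4 * ε) ≤ R := by linarith
      rw [div_le_iff₀ (by positivity)] at h2
      linarith
    calc s * |E.imbalance i X| ≤ s * (4 * R * ε) := mul_le_mul_of_nonneg_left h1 hs0.le
      _ = s * (4 * R) * ε := by ring
      _ ≤ 1 * ε := mul_le_mul_of_nonneg_right (hsR.trans hβ1) hε.le
      _ = ε := one_mul ε
  · intro z hz hzb
    have h1 := P.opt_le z hz hzb
    have hW : E.welfare (s • X) ≤ E.welfare x := by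
      rw [← welfareHom_apply E x, hx, map_add, welfareHom_apply, welfareHom_apply]
      exact le_add_of_nonneg_left (E.welfare_nonneg M.nonneg)
    have hW' : β * g ≤ 20 * K * E.welfare (s • X) := by
      have h2 : E.welfareHom X = R * g := by rw [hR]; field_simp
      rw [← welfareHom_apply, map_smul, smul_eq_mul, h2, hs]
      have h3 : t * K + 4 * R ≤ 20 * K * R := by
        have hK1 : (1 : ℝ) ≤ K := by exact_mod_cast hK0
        nlinarith [mul_le_mul_of_nonneg_right hR0 hK'.le]
      rw [div_mul_eq_mul_div, mul_div_assoc', le_div_iff₀ hden]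
      have := mul_le_mul_of_nonneg_left h3 (by positivity : 0 ≤ β * g)
      linarith
    have hWx : 0 ≤ E.welfare x := E.welfare_nonneg hxnn
    have hKb := bucket_count_le hn hε hK
    have h4 : β * g ≤ 20 * (4 / Real.log 2 * Real.log (max (n : ℝ) (1 / ε))) * E.welfare x :=
      calc β * g ≤ 20 * K * E.welfare (s • X) := hW'
        _ ≤ 20 * K * E.welfare x := by gcongr
        _ ≤ _ := by gcongr
    rw [div_mul_eq_mul_div, le_div_iff₀ hβ]
    have h5 : 160 / Real.log 2 * Real.log (max (n : ℝ) (1 / ε)) * E.welfare x =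
      2 * (20 * (4 / Real.log 2 * Real.log (max (n : ℝ) (1 / ε))) * E.welfare x) := by ring
    rw [h5]
    nlinarith
  · have hmono : ∀ i, E.utilityHom i y ≤ E.utility x i := fun i => by
      change _ ≤ E.utilityHom i x
      rw [hx, map_add]
      exact le_add_of_nonneg_right (E.utility_nonneg hXnn i)
    refine isApproxStable_two hγ fun i j => ?_
    by_cases hi : i ∈ D
    · exact (M.stable i hi j).trans (max_le_max (hmono i) (hmono j))
    by_cases hj : j ∈ D
    · rw [pairValue_comm, max_comm]
      exact (M.stable j hj i).trans (max_le_max (hmono j) (hmono i))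
    rw [hD i j hi hj, mul_zero]
    exact le_max_of_le_left (E.utility_nonneg hxnn i)

end DataExchange

namespace RealRAM

open DataExchange

variable {n : ℕ} {E : DataExchange n}

/-! ### The program

Scalars and arrays of natural numbers: `0` number of agents, `1` number of entries of the output,
`2` agents of the entries, `3` sets of the entries, `4` identity matrix, `5`, `6`, `7` loop
variables, `8` number of buckets, `9` number of rounds, `10` index of the next proposed entry,
`11`, `12` selected pair, `13`, `14` loop variables, `15` number of entries for the matching.

Scalars and arrays of real numbers: `0`, `1` the parameters, `2` probabilities of the entries,
`3`, `4` weights minus one, `5` sum of the weights, `6` guess for the welfare, `7` thresholds,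
`8` imbalances of the proposal, `9` value of the proposal, `10` welfare of the proposal, `11` total
welfare, `12`, `13` answers to calls, `14` utilities of single agents, `15` values of pairs, `16`
step size, `17` final factor, `18` prices. -/

@[simp] theorem setInt_ints (σ : Store) (a r s v a' r' s' : ℕ) :
    (σ.setInt a r s v).ints a' r' s' =
      if a' = a ∧ r' = r ∧ s' = s then v else σ.ints a' r' s' := rfl

@[simp] theorem setInt_reals (σ : Store) (a r s v : ℕ) : (σ.setInt a r s v).reals = σ.reals := rfl

@[simp] theorem setReal_ints (σ : Store) (a r s : ℕ) (v : ℝ) :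
    (σ.setReal a r s v).ints = σ.ints := rfl

@[simp] theorem setReal_reals (σ : Store) (a r s : ℕ) (v : ℝ) (a' r' s' : ℕ) :
    (σ.setReal a r s v).reals a' r' s' =
      if a' = a ∧ r' = r ∧ s' = s then v else σ.reals a' r' s' := rfl

theorem rowSet_congr {σ τ : Store} {a k : ℕ} (h : ∀ s < n, σ.ints a k s = τ.ints a k s) :
    σ.rowSet n a k = τ.rowSet n a k := by
  ext j
  simp [Store.rowSet, h j j.2]

theorem rowSet_eq_singleton {σ : Store} {a k : ℕ} {j : Fin n}
    (h : ∀ s < n, σ.ints a k s ≠ 0 ↔ s = j) : σ.rowSet n a k = {j} := by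
  ext i
  simp only [Store.rowSet, mem_filter, mem_univ, true_and, mem_singleton, h i i.2, Fin.ext_iff]

theorem utilityAnswer_val (i : Fin n) (S : Finset (Fin n)) :
    utilityAnswer E i S = E.u i (S.erase i) := by
  simp [utilityAnswer]

/-- The lottery that consists of the `e`-th entry of the output alone. -/
def entry (n : ℕ) (σ : Store) (e : ℕ) : Fin n → Finset (Fin n) → ℝ :=
  atom (σ.ints 2 e 0) (σ.rowSet n 3 e)

theorem output_eq_sum (σ : Store) :
    σ.output n = ∑ e ∈ range (σ.ints 1 0 0), σ.reals 2 e 0 • entry n σ e := by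
  funext i S
  simp [Store.output, entry, atom]

theorem entry_congr {σ τ : Store} {e : ℕ} (h : σ.ints 2 e 0 = τ.ints 2 e 0)
    (h' : ∀ s < n, σ.ints 3 e s = τ.ints 3 e s) : entry n σ e = entry n τ e := by
  rw [entry, entry, h, rowSet_congr h']

/-- Computes the number of buckets and their thresholds. -/
def thresholds : Cmd :=
  .seq (setVecR 7 (.lit 0) (.div (rlit 1) (rlit 2)))
    (.loop (.rle (rvec 7 (iscal 8)) (.div (.ofInt (iscal 0)) (rscal 0)))
      (.seq (setVecR 7 (.succ (iscal 8)) (.add (rvec 7 (iscal 8)) (rvec 7 (iscal 8))))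
        (setScalI 8 (.succ (iscal 8)))))

theorem thresholds_runs {σ : Store} {ε : ℝ} {N : ℕ} (hn : 2 ≤ n) (hε : 0 < ε) (hε1 : ε < 1)
    (hN : 2 * (n / ε) < N) (h0 : σ.ints 0 0 0 = n) (h8 : σ.ints 8 0 0 = 0)
    (hr : σ.reals 0 0 0 = ε) :
    Runs E thresholds σ (50 * N + 50) fun τ => ∃ K, τ.ints 8 0 0 = K ∧ 1 ≤ K ∧ K ≤ N ∧
      (2 : ℝ) ^ K ≤ 4 * (n / ε) ∧ n / ε < 2 ^ K / 2 ∧ ∀ k < K, τ.reals 7 k 0 = 2 ^ k / 2 := by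
  have hn' : (2 : ℝ) ≤ n := by exact_mod_cast hn
  have h2 : 2 ≤ n / ε := by rw [le_div_iff₀ hε]; linarith
  -- `m < 2 ^ m ≤ 2 * (n / ε) < N`, a crude bound for the number of thresholds.
  have key : ∀ m : ℕ, (2 : ℝ) ^ m / 2 ≤ n / ε → m < N := fun m hm => by
    have h3 : (m : ℝ) < 2 ^ m := by exact_mod_cast Nat.lt_two_pow_self
    have : (m : ℝ) < N := by linarith
    exact_mod_cast this
  refine (Runs.seq (Runs.of_run (Q := fun τ => τ = σ.setReal 7 0 0 (1 / 2)) rfl ?_)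
    (c' := (N - 0) * (24 + 14) + 14) ?_).mono ?_ fun τ _ h => h
  · simp [Cmd.run, IExp.eval, RExp.eval]
  · rintro τ - rfl
    refine (Runs.loop (l := 0) (M := N) (c := 24)
      (I := fun m τ => τ.ints 8 0 0 = m ∧ (∀ k ≤ m, τ.reals 7 k 0 = 2 ^ k / 2) ∧
        (2 : ℝ) ^ m ≤ 4 * (n / ε)) ?_ ?_ ?_ ?_).mono ?_ fun τ _ h => h
    · refine ⟨by simp [h8], ?_, by simp; linarith⟩
      intro k hk
      obtain rfl : k = 0 := by omega
      simp
    · rintro m τ hF ⟨h1, h3, -⟩ hb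
      have e1 := hF.ints 0 (by decide)
      have e2 := hF.reals 0 (by decide)
      simp only [Test.holds, RExp.eval, IExp.eval, e1, e2, setReal_ints, setReal_reals, h0, h1,
        h3 m le_rfl] at hb
      simp only [show (0 : ℕ) ≠ 7 by decide, false_and, if_false, hr] at hb
      exact key m hb
    · rintro m τ hF ⟨h1, h3, h4⟩ hb
      have e1 := hF.ints 0 (by decide)
      have e2 := hF.reals 0 (by decide)
      simp only [Test.holds, RExp.eval, IExp.eval, e1, e2, setReal_ints, setReal_reals, h0, h1,
        h3 m le_rfl] at hb
      simp only [show (0 : ℕ) ≠ 7 by decide, false_and, if_false, hr] at hb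
      refine (Runs.of_run rfl ?_).mono (by decide) fun τ _ h => h
      refine ⟨by simp [Cmd.run, IExp.eval, h1], fun k hk => ?_, by rw [pow_succ]; linarith⟩
      rcases hk.lt_or_eq with hk | rfl
      · simp [Cmd.run, IExp.eval, h1, h3 k (by omega), (show k ≠ m + 1 by omega)]
      · simp [Cmd.run, IExp.eval, RExp.eval, h1, h3 m le_rfl, pow_succ]
    · rintro m τ hF ⟨h1, h3, h4⟩ hb
      have e1 := hF.ints 0 (by decide)
      have e2 := hF.reals 0 (by decide)
      simp only [Test.holds, RExp.eval, IExp.eval, e1, e2, setReal_ints, setReal_reals, h0, h1,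
        h3 m le_rfl] at hb
      simp only [show (0 : ℕ) ≠ 7 by decide, false_and, if_false, hr, not_le] at hb
      have hm : 1 ≤ m := by
        rcases Nat.eq_zero_or_pos m with rfl | h
        · norm_num at hb; linarith
        · exact h
      refine ⟨m, h1, hm, ?_, h4, hb, fun k hk => h3 k hk.le⟩
      -- The invariant `2 ^ m ≤ 4 * (n / ε)` says that the test succeeded at `m - 1`.
      have h5 := key (m - 1) (by
        obtain ⟨l, rfl⟩ : ∃ l, m = l + 1 := ⟨m - 1, by omega⟩
        rw [pow_succ] at h4
        simp only [Nat.add_sub_cancel]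
        linarith)
      omega
    · simp [Test.cost, RExp.cost, IExp.cost]
  · simp [Cmd.cost, RExp.cost, IExp.cost]
    omega

/-! ### Pair values and greedy matching on the machine -/

def pairTableBody : Cmd :=
  .seq (.iset 4 (iscal 5) (iscal 5) (.lit 1)) <|
  .seq (.iset 4 (iscal 6) (iscal 6) (.lit 1)) <|
  .seq (.callUtility 14 (iscal 5) (iscal 6) (iscal 5) 4 (iscal 6)) <|
  .seq (.callUtility 12 (.lit 0) (.lit 0) (iscal 6) 4 (iscal 5)) <|
  .ite (.rle (.arr 14 (iscal 5) (iscal 6)) (rscal 12))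
    (.rset 15 (iscal 5) (iscal 6) (.arr 14 (iscal 5) (iscal 6)))
    (.rset 15 (iscal 5) (iscal 6) (rscal 12))

/-- Computes the utilities of all agents for the data of single agents. -/
def pairTable : Cmd := .for 5 (.lit 0) 0 (.for 6 (.lit 0) 0 pairTableBody)

/-- A row of array 4 is a singleton once its diagonal entry is written, so both writes precede the
calls; repeating them is harmless. For `i = j` the answer ignores `i` in the set, which matches the
`erase` in `pairUtility`. -/
theorem pairTableBody_runs {σ : Store} {i j : Fin n} (hi : σ.ints 5 0 0 = i)
    (hj : σ.ints 6 0 0 = j) (h4 : ∀ r s, r ≠ s → σ.ints 4 r s = 0) :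
    Runs E pairTableBody σ 80 fun τ => (∀ r s, r ≠ s → τ.ints 4 r s = 0) ∧
      (∀ a b, τ.reals 14 a b = if a = i ∧ b = j then E.pairUtility i j else σ.reals 14 a b) ∧
      (∀ a b, τ.reals 15 a b = if a = i ∧ b = j then E.pairValue i j else σ.reals 15 a b) := by
  have h1 : ((σ.setInt 4 i i 1).setInt 4 j j 1).rowSet n 4 j = {j} := by
    refine rowSet_eq_singleton fun s hs => ?_
    by_cases h : s = j
    · simp [h]
    · have h' : ¬ ((j : ℕ) = i ∧ s = i) := fun h' => h (h'.2.trans h'.1.symm)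
      simp [h, h', h4 j s (Ne.symm h)]
  have h2 : ((σ.setInt 4 i i 1).setInt 4 j j 1).rowSet n 4 i = {i} := by
    refine rowSet_eq_singleton fun s hs => ?_
    by_cases h : s = i
    · subst h; simp
    · have h' : ¬ ((i : ℕ) = j ∧ s = j) := fun h' => h (h'.2.trans h'.1.symm)
      simp [h, h', h4 i s (Ne.symm h)]
  have h3 : ∀ (ρ : Store) (a r s : ℕ) (v : ℝ) (k : ℕ),
      (ρ.setReal a r s v).rowSet n 4 k = ρ.rowSet n 4 k := fun _ _ _ _ _ _ => rfl
  refine (Runs.of_run rfl ?_).mono (by decide) fun τ _ h => h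
  have h5 : ∀ a b, E.u a (({b} : Finset (Fin n)).erase a) = E.pairUtility a b := fun _ _ => rfl
  simp only [pairTableBody, Cmd.run, IExp.eval, RExp.eval, Test.holds, setInt_ints, setReal_ints,
    setReal_reals, setInt_reals, hi, hj, h1, h2, h3, utilityAnswer_val, h5,
    Nat.reduceEqDiff, false_and, and_self, if_true, if_false]
  refine ⟨?_, ?_, ?_⟩
  · intro r s hrs
    have h6 : ¬ (r = j ∧ s = j) := fun h => hrs (h.1.trans h.2.symm)
    have h7 : ¬ (r = i ∧ s = i) := fun h => hrs (h.1.trans h.2.symm)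
    split_ifs <;> simp [h6, h7, h4 r s hrs]
  · intro a b
    split_ifs <;> simp_all
  · intro a b
    unfold pairValue
    split_ifs with h6 h7 h7
    · simp [h7, min_eq_left h6]
    · simp [h7]
    · simp [h7, min_eq_right (not_le.1 h6).le]
    · simp [h7]

theorem pairTable_runs {σ : Store} (h0 : σ.ints 0 0 0 = n)
    (h4 : ∀ r s, r ≠ s → σ.ints 4 r s = 0) :
    Runs E pairTable σ (n * (n * 94 + 25) + 11) fun τ => ∀ i j : Fin n,
      τ.reals 14 i j = E.pairUtility i j ∧ τ.reals 15 i j = E.pairValue i j := by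
  refine (Runs.for (l := 0) (N := n) (c := n * 94 + 11)
    (fun i τ => (∀ r s, r ≠ s → τ.ints 4 r s = 0) ∧ ∀ a b : Fin n, (a : ℕ) < i →
      τ.reals 14 a b = E.pairUtility a b ∧ τ.reals 15 a b = E.pairValue a b)
    (by decide) (by decide) (by decide) rfl h0 (Nat.zero_le _) ?_ ⟨h4, fun a b h => by omega⟩
    ?_ ?_).mono ?_ fun τ _ h => h
  · rintro k τ x ⟨h1, h2⟩
    exact ⟨by simpa using h1, by simpa using h2⟩
  · rintro i τ hF - hi h5 ⟨h1, h2⟩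
    have e0 := hF.ints 0 (by decide)
    refine (Runs.for (l := 0) (N := n) (c := 80)
      (fun j τ => (∀ r s, r ≠ s → τ.ints 4 r s = 0) ∧ ∀ a b : Fin n,
        ((a : ℕ) < i ∨ (a : ℕ) = i ∧ (b : ℕ) < j) →
        τ.reals 14 a b = E.pairUtility a b ∧ τ.reals 15 a b = E.pairValue a b)
      (by decide) (by decide) (by decide) rfl (by rw [e0, h0]) (Nat.zero_le _) ?_
      ⟨h1, fun a b h => h2 a b (by omega)⟩ ?_ ?_).mono ?_ fun τ _ h => h
    · rintro k τ x ⟨h1, h2⟩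
      exact ⟨by simpa using h1, by simpa using h2⟩
    · rintro j ρ hFρ - hj h6 ⟨h1, h2⟩
      have e5 := hFρ.ints 5 (by decide)
      refine (pairTableBody_runs (i := ⟨i, hi⟩) (j := ⟨j, hj⟩) (by rw [e5, h5]) h6 h1).mono le_rfl ?_
      rintro υ - ⟨h7, h8, h9⟩
      refine ⟨h7, fun a b hab => ?_⟩
      rw [h8, h9]
      by_cases h10 : (a : ℕ) = i ∧ (b : ℕ) = j
      · obtain ⟨rfl, rfl⟩ := h10
        simp
      · simpa only [h10, if_false] using h2 a b (by omega)
    · rintro υ - ⟨h7, h8⟩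
      exact ⟨h7, fun a b hab => h8 a b (by omega)⟩
    · simp [IExp.cost]; try ring_nf; try omega
  · rintro τ - ⟨-, h⟩ i j
    exact h i j i.2
  · simp [IExp.cost]; try ring_nf; try omega

def selectPairBody : Cmd :=
  .ite (.neg (.rle (.arr 15 (iscal 5) (iscal 6)) (.arr 15 (iscal 11) (iscal 12))))
    (.seq (setScalI 11 (iscal 5)) (setScalI 12 (iscal 6))) .skip

/-- Selects a pair of largest value. -/
def selectPair : Cmd :=
  .seq (.seq (setScalI 11 (.lit 0)) (setScalI 12 (.lit 0)))
    (.for 5 (.lit 0) 0 (.for 6 (.lit 0) 0 selectPairBody))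

theorem selectPairBody_runs {σ : Store} {i j a b : ℕ} (hi : σ.ints 5 0 0 = i)
    (hj : σ.ints 6 0 0 = j) (ha : σ.ints 11 0 0 = a) (hb : σ.ints 12 0 0 = b) :
    Runs E selectPairBody σ 40 fun τ => ∃ a' b', τ.ints 11 0 0 = a' ∧ τ.ints 12 0 0 = b' ∧
      (a' = i ∧ b' = j ∨ a' = a ∧ b' = b) ∧ σ.reals 15 i j ≤ σ.reals 15 a' b' ∧
      σ.reals 15 a b ≤ σ.reals 15 a' b' := by
  refine (Runs.of_run rfl ?_).mono (by decide) fun τ _ h => h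
  by_cases h : σ.reals 15 i j ≤ σ.reals 15 a b
  · exact ⟨a, b, by simp [selectPairBody, Cmd.run, IExp.eval, RExp.eval, Test.holds, *]⟩
  · refine ⟨i, j, ?_⟩
    have := (not_le.1 h).le
    simp [selectPairBody, Cmd.run, IExp.eval, RExp.eval, Test.holds, *]

theorem selectPair_runs {σ : Store} (hn : 0 < n) (h0 : σ.ints 0 0 0 = n) :
    Runs E selectPair σ (n * (n * 54 + 25) + 19) fun τ => ∃ a b : Fin n,
      τ.ints 11 0 0 = a ∧ τ.ints 12 0 0 = b ∧
      ∀ i j : Fin n, σ.reals 15 i j ≤ σ.reals 15 a b := by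
  have hz : Runs E (.seq (setScalI 11 (.lit 0)) (setScalI 12 (.lit 0))) σ 8
      fun τ => τ.ints 11 0 0 = 0 ∧ τ.ints 12 0 0 = 0 :=
    (Runs.of_run rfl (by simp [Cmd.run, IExp.eval])).mono (by decide) fun τ _ h => h
  refine (Runs.seq (c' := n * (n * 54 + 25) + 11) hz ?_).mono (by omega) fun τ _ h => h
  rintro τ hFτ ⟨h11, h12⟩
  have e0 := hFτ.ints 0 (by decide)
  have e15 := hFτ.reals 15 (by decide)
  refine (Runs.for (l := 0) (N := n) (c := n * 54 + 11)
    (fun i τ => ∃ a b : Fin n, τ.ints 11 0 0 = a ∧ τ.ints 12 0 0 = b ∧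
      ∀ i' j' : Fin n, (i' : ℕ) < i → σ.reals 15 i' j' ≤ σ.reals 15 a b)
    (by decide) (by decide) (by decide) rfl (by rw [e0, h0]) (Nat.zero_le _) ?_
    ⟨⟨0, hn⟩, ⟨0, hn⟩, h11, h12, fun _ _ h => by omega⟩ ?_ ?_).mono ?_ fun τ _ h => h
  · rintro k τ x ⟨a, b, h1, h2, h3⟩
    exact ⟨a, b, by simpa using h1, by simpa using h2, h3⟩
  · rintro i ρ hFρ - hi h5 ⟨a, b, h1, h2, h3⟩
    have f0 := hFρ.ints 0 (by decide)
    have f15 := hFρ.reals 15 (by decide)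
    refine (Runs.for (l := 0) (N := n) (c := 40)
      (fun j τ => ∃ a b : Fin n, τ.ints 11 0 0 = a ∧ τ.ints 12 0 0 = b ∧
        ∀ i' j' : Fin n, ((i' : ℕ) < i ∨ (i' : ℕ) = i ∧ (j' : ℕ) < j) →
          σ.reals 15 i' j' ≤ σ.reals 15 a b)
      (by decide) (by decide) (by decide) rfl (by rw [f0, e0, h0]) (Nat.zero_le _) ?_
      ⟨a, b, h1, h2, fun i' j' h => h3 i' j' (by omega)⟩ ?_ ?_).mono ?_ fun τ _ h => h
    · rintro k τ x ⟨a, b, h1, h2, h3⟩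
      exact ⟨a, b, by simpa using h1, by simpa using h2, h3⟩
    · rintro j υ hFυ - hj h6 ⟨a, b, h1, h2, h3⟩
      have g5 := hFυ.ints 5 (by decide)
      have g15 : υ.reals 15 = σ.reals 15 := by rw [hFυ.reals 15 (by decide), f15, e15]
      refine (selectPairBody_runs (i := i) (j := j) (by rw [g5, h5]) h6 h1 h2).mono le_rfl ?_
      rintro χ - ⟨a', b', h7, h8, h9, h10, h11⟩
      rw [g15] at h10 h11
      have hab : ∃ a'' b'' : Fin n, a' = a'' ∧ b' = b'' := by
        rcases h9 with h9 | h9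
        · exact ⟨⟨i, hi⟩, ⟨j, hj⟩, h9⟩
        · exact ⟨a, b, h9⟩
      obtain ⟨a'', b'', rfl, rfl⟩ := hab
      refine ⟨a'', b'', h7, h8, fun i' j' h => ?_⟩
      by_cases h12 : (i' : ℕ) = i ∧ (j' : ℕ) = j
      · rw [h12.1, h12.2]; exact h10
      · exact (h3 i' j' (by omega)).trans h11
    · rintro υ - ⟨a, b, h1, h2, h3⟩
      exact ⟨a, b, h1, h2, fun i' j' h => h3 i' j' (by omega)⟩
    · simp [IExp.cost]; try ring_nf; try omega
  · rintro υ - ⟨a, b, h1, h2, h3⟩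
    exact ⟨a, b, h1, h2, fun i' j' => h3 i' j' i'.2⟩
  · simp [IExp.cost]; try ring_nf; try omega

/-- Appends an entry for the agent in `a` that trades with the agent in `b`. -/
def recordTrade (a b : ℕ) : Cmd :=
  .seq (.iset 2 (iscal 1) (.lit 0) (iscal a)) <|
  .seq (.iset 3 (iscal 1) (iscal b) (.lit 1)) <|
  .seq (.rset 2 (iscal 1) (.lit 0) (.div
    (.mul (.sub (rlit 1) (rscal 1)) (.arr 15 (iscal 11) (iscal 12))) (.arr 14 (iscal a) (iscal b))))
    (setScalI 1 (.succ (iscal 1)))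

/-- By `h3` row `L` is still blank, so a single write turns it into a singleton. -/
theorem recordTrade_runs {σ : Store} {a b L : ℕ} {i j : Fin n} (ha : a = 11 ∨ a = 12)
    (hb : b = 11 ∨ b = 12) (hi : σ.ints a 0 0 = i) (hj : σ.ints b 0 0 = j)
    (h1 : σ.ints 1 0 0 = L) (h3 : ∀ e, L ≤ e → ∀ s, σ.ints 3 e s = 0) :
    Runs E (recordTrade a b) σ 60 fun τ => τ.ints 1 0 0 = L + 1 ∧
      (∀ e, L + 1 ≤ e → ∀ s, τ.ints 3 e s = 0) ∧
      τ.output n = σ.output n + ((1 - σ.reals 1 0 0) *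
        σ.reals 15 (σ.ints 11 0 0) (σ.ints 12 0 0) / σ.reals 14 i j) • atom (i : ℕ) {j} := by
  have hc : (recordTrade a b).cost ≤ 60 := by
    rcases ha with rfl | rfl <;> rcases hb with rfl | rfl <;> decide
  refine (Runs.of_run rfl ?_).mono hc fun τ _ h => h
  have ha1 : a ≠ 1 ∧ a ≠ 2 ∧ a ≠ 3 := by omega
  have hb1 : b ≠ 1 ∧ b ≠ 2 ∧ b ≠ 3 := by omega
  have key : (recordTrade a b).run E σ =
      ((((σ.setInt 2 L 0 i).setInt 3 L j 1).setReal 2 L 0 ((1 - σ.reals 1 0 0) *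
        σ.reals 15 (σ.ints 11 0 0) (σ.ints 12 0 0) / σ.reals 14 i j)).setInt 1 0 0 (L + 1)) := by
    simp [recordTrade, Cmd.run, IExp.eval, RExp.eval, ha1, hb1, hi, hj, h1]
  rw [key]
  refine ⟨by simp, ?_, ?_⟩
  · intro e he s
    have : e ≠ L := by omega
    simp [this, h3 e (by omega) s]
  · rw [output_eq_sum, output_eq_sum]
    simp only [setInt_ints, and_self, if_true, h1, sum_range_succ]
    congr 1
    · refine sum_congr rfl fun e he => ?_
      have he' : e ≠ L := (mem_range.1 he).ne
      rw [entry_congr (τ := σ) (by simp [he']) (by simp [he'])]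
      simp [he']
    · have : Store.rowSet ((((σ.setInt 2 L 0 i).setInt 3 L j 1).setReal 2 L 0
          ((1 - σ.reals 1 0 0) * σ.reals 15 (σ.ints 11 0 0) (σ.ints 12 0 0) /
            σ.reals 14 i j)).setInt 1 0 0 (L + 1)) n 3 L = {j} := by
        refine rowSet_eq_singleton fun s _ => ?_
        by_cases hs : s = j <;> simp [hs, h3 L le_rfl]
      rw [entry, this]
      simp

def clearPairBody : Cmd :=
  .seq (.rset 15 (iscal 11) (iscal 6) (rlit 0)) <|
  .seq (.rset 15 (iscal 6) (iscal 11) (rlit 0)) <|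
  .seq (.rset 15 (iscal 12) (iscal 6) (rlit 0)) (.rset 15 (iscal 6) (iscal 12) (rlit 0))

/-- Removes the selected pair from the table of values. -/
def clearPair : Cmd := .for 6 (.lit 0) 0 clearPairBody

theorem clearPair_runs {σ : Store} {a b : Fin n} (h0 : σ.ints 0 0 0 = n)
    (ha : σ.ints 11 0 0 = a) (hb : σ.ints 12 0 0 = b) :
    Runs E clearPair σ (n * 54 + 11) fun τ => ∀ i j : Fin n, τ.reals 15 i j =
      if (i = a ∨ i = b) ∨ (j = a ∨ j = b) then 0 else σ.reals 15 i j := by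
  refine (Runs.for (l := 0) (N := n) (c := 40)
    (fun l τ => ∀ i j : Fin n, τ.reals 15 i j =
      if ((i = a ∨ i = b) ∧ (j : ℕ) < l) ∨ ((j = a ∨ j = b) ∧ (i : ℕ) < l) then 0
      else σ.reals 15 i j)
    (by decide) (by decide) (by decide) rfl h0 (Nat.zero_le _) ?_ (fun _ _ => by simp)
    ?_ ?_).mono ?_ fun τ _ h => h
  · intro k τ x h i j
    simpa using h i j
  · intro l τ hF _ hl h6 h
    have e11 := hF.ints 11 (by decide)
    have e12 := hF.ints 12 (by decide)
    refine (Runs.of_run rfl ?_).mono (by decide) fun τ _ h => h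
    intro i j
    have hij := h i j
    simp only [clearPairBody, Cmd.run, IExp.eval, RExp.eval, setReal_ints, setReal_reals, h6, e11,
      e12, ha, hb, Nat.cast_zero, true_and, hij, Fin.ext_iff]
    clear hij
    by_cases hil : (i : ℕ) = l <;> by_cases hjl : (j : ℕ) = l <;>
    split_ifs <;> first | rfl | (exfalso; omega)
  · intro τ _ h i j
    rw [h i j]
    simp
  · simp [IExp.cost]; try ring_nf; try omega

/-- Greedy matching of the agents by the values of pairs. -/
def greedyMatching : Cmd :=
  .for 13 (.lit 0) 0
    (.seq selectPair (.seq (.seq (recordTrade 11 12) (recordTrade 12 11)) clearPair))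

theorem greedyMatching_runs {σ : Store} {β : ℝ} (hn : 0 < n) (hβ1 : β ≤ 1)
    (h0 : σ.ints 0 0 0 = n) (h1 : σ.ints 1 0 0 = 0) (h3 : ∀ e s, σ.ints 3 e s = 0)
    (hr : σ.reals 1 0 0 = β) (h14 : ∀ i j : Fin n, σ.reals 14 i j = E.pairUtility i j)
    (h15 : ∀ i j : Fin n, σ.reals 15 i j = E.pairValue i j) :
    Runs E greedyMatching σ (n * (n * (n * 54 + 25) + n * 54 + 164) + 11) fun τ =>
      ∃ D, Matching E (1 - β) D (τ.output n) ∧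
        ∀ i j, i ∉ D → j ∉ D → E.pairValue i j = 0 := by
  refine (Runs.for (l := 0) (N := n) (c := n * (n * 54 + 25) + n * 54 + 150)
    (fun r τ => (∃ L, τ.ints 1 0 0 = L ∧ ∀ e, L ≤ e → ∀ s, τ.ints 3 e s = 0) ∧
      ∃ D, Matching E (1 - β) D (τ.output n) ∧
        (∀ i j : Fin n, τ.reals 15 i j = if i ∈ D ∨ j ∈ D then 0 else E.pairValue i j) ∧
        -- Each iteration either enlarges `D` or finds no pair of positive value left; after `n`
        -- iterations the first alternative makes `D` everything.
        (r ≤ #D ∨ ∀ i j, i ∉ D → j ∉ D → E.pairValue i j = 0))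
    (by decide) (by decide) (by decide) rfl h0 (Nat.zero_le _) ?_ ?_ ?_ ?_).mono ?_ fun τ _ h => h
  · rintro r τ x ⟨⟨L, h4, h5⟩, D, h6, h7, h8⟩
    refine ⟨⟨L, by simpa using h4, by simpa using h5⟩, D, ?_, by simpa using h7, h8⟩
    rw [output_eq_sum] at h6 ⊢
    exact h6
  · refine ⟨⟨0, h1, fun e _ s => h3 e s⟩, ∅, ?_, by simpa using h15, by simp⟩
    rw [output_eq_sum, h1]
    exact Matching.empty E _
  · rintro r τ hF - hrn - ⟨⟨L, h4, h5⟩, D, h6, h7, h8⟩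
    have e0 : τ.ints 0 0 0 = n := by rw [hF.ints 0 (by decide), h0]
    have e1 : τ.reals 1 0 0 = β := by rw [hF.reals 1 (by decide), hr]
    have e14 : ∀ i j : Fin n, τ.reals 14 i j = E.pairUtility i j := fun i j => by
      rw [hF.reals 14 (by decide), h14]
    refine (Runs.seq (selectPair_runs hn e0) (c' := 60 + 60 + (n * 54 + 11)) ?_).mono (by omega)
      fun τ _ h => h
    rintro τ₁ hF₁ ⟨a, b, ha, hb, hmax⟩
    have hout : τ₁.output n = τ.output n := by
      rw [output_eq_sum, output_eq_sum, hF₁.ints 1 (by decide), hF₁.reals 2 (by decide)]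
      refine sum_congr rfl fun e _ => ?_
      rw [entry_congr (τ := τ)]
      · rw [hF₁.ints 2 (by decide)]
      · rw [hF₁.ints 3 (by decide)]; simp
    refine Runs.seq (Runs.seq (recordTrade_runs (L := L) (i := a) (j := b) (by simp) (by simp)
      ha hb (by rw [hF₁.ints 1 (by decide), h4]) (by rw [hF₁.ints 3 (by decide)]; exact h5)) ?_
      (Q := fun τ₂ => τ₂.ints 1 0 0 = L + 2 ∧ (∀ e, L + 2 ≤ e → ∀ s, τ₂.ints 3 e s = 0) ∧
        τ₂.output n = τ.output n +
          (((1 - β) * τ.reals 15 a b / E.pairUtility a b) • atom (a : ℕ) {b} +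
            ((1 - β) * τ.reals 15 a b / E.pairUtility b a) • atom (b : ℕ) {a}))) ?_
    · rintro τ₂ hF₂ ⟨g1, g3, g⟩
      refine (recordTrade_runs (L := L + 1) (i := b) (j := a) (by simp) (by simp)
        (by rw [hF₂.ints 12 (by decide), hb]) (by rw [hF₂.ints 11 (by decide), ha]) g1 g3).mono
        le_rfl ?_
      rintro τ₃ - ⟨k1, k3, k⟩
      refine ⟨k1, k3, ?_⟩
      rw [k, g, hout, hF₂.reals 1 (by decide), hF₂.reals 15 (by decide), hF₂.reals 14 (by decide),
        hF₂.ints 11 (by decide), hF₂.ints 12 (by decide), ha, hb, hF₁.reals 1 (by decide),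
        hF₁.reals 15 (by decide), hF₁.reals 14 (by decide), e1, e14, e14, add_assoc]
    rintro τ₂ hF₂ ⟨g1, g3, g⟩
    refine (clearPair_runs (a := a) (b := b)
      (by rw [hF₂.ints 0 (by decide), hF₁.ints 0 (by decide), e0])
      (by rw [hF₂.ints 11 (by decide), ha]) (by rw [hF₂.ints 12 (by decide), hb])).mono le_rfl ?_
    rintro τ₃ hF₃ k15
    have e15 : τ₂.reals 15 = τ.reals 15 := by
      rw [hF₂.reals 15 (by decide), hF₁.reals 15 (by decide)]
    have hout₃ : τ₃.output n = τ₂.output n := by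
      rw [output_eq_sum, output_eq_sum, hF₃.ints 1 (by decide), hF₃.reals 2 (by decide)]
      refine sum_congr rfl fun e _ => ?_
      rw [entry_congr (τ := τ₂)]
      · rw [hF₃.ints 2 (by decide)]
      · rw [hF₃.ints 3 (by decide)]; simp
    refine ⟨⟨L + 2, by rw [hF₃.ints 1 (by decide), g1], by rw [hF₃.ints 3 (by decide)]; exact g3⟩,
      ?_⟩
    by_cases hab : a ∉ D ∧ b ∉ D ∧ 0 < E.pairValue a b
    · obtain ⟨haD, hbD, hpos⟩ := hab
      have hv : τ.reals 15 a b = E.pairValue a b := by rw [h7]; simp [haD, hbD]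
      refine ⟨insert a (insert b D), ?_, ?_, ?_⟩
      · rw [hout₃, g, hv]
        refine h6.insert_pair (sub_nonneg.2 hβ1) haD hbD hpos fun i j hi hj => ?_
        have := hmax i j
        rwa [hv, h7, if_neg (by tauto)] at this
      · intro i j
        rw [k15, e15, h7]
        simp only [mem_insert]
        split_ifs <;> first | rfl | (exfalso; tauto)
      · rcases h8 with h8 | h8
        · left
          have : #D < #(insert a (insert b D)) := by
            refine card_lt_card ⟨?_, fun h => haD (h (mem_insert_self _ _))⟩
            exact (subset_insert _ _).trans (subset_insert _ _)
          omega
        · exact absurd (h8 a b haD hbD) hpos.ne'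
    -- The largest remaining value is zero: the recorded trades get probability zero, and clearing
    -- does not change the table.
    · have hv : τ.reals 15 a b = 0 := by
        rw [h7]
        split_ifs with h
        · rfl
        · rw [not_or] at h
          have h9 : ¬ 0 < E.pairValue a b := fun h' => hab ⟨h.1, h.2, h'⟩
          exact le_antisymm (not_lt.1 h9) (E.pairValue_nonneg a b)
      have hz : ∀ i j : Fin n, τ.reals 15 i j = 0 := fun i j => by
        refine le_antisymm ((hmax i j).trans hv.le) ?_
        rw [h7]
        split_ifs
        · exact le_rfl
        · exact E.pairValue_nonneg i j
      refine ⟨D, ?_, ?_, ?_⟩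
      · rw [hout₃, g, hv]
        simpa using h6
      · intro i j
        rw [k15, e15, ← h7, hz]
        simp
      · right
        intro i j hi hj
        have := h7 i j
        rw [hz, if_neg (by tauto)] at this
        exact this.symm
  · rintro τ - ⟨-, D, h6, -, h8⟩
    refine ⟨D, h6, ?_⟩
    rcases h8 with h8 | h8
    · have : D = univ := by
        rw [← card_eq_iff_eq_univ, Fintype.card_fin]
        exact le_antisymm ((card_le_univ D).trans (by simp)) h8
      simp [this]
    · exact h8
  · simp [IExp.cost]; try ring_nf; try omega

/-! ### One round of multiplicative weights on the machine -/

def startRoundBody : Cmd :=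
  .seq (setVecR 8 (iscal 5) (rlit 0))
    (setVecR 18 (iscal 5) (.mul (.div (rscal 6) (.mul (rlit 4) (rscal 0)))
      (.div (.sub (rvec 4 (iscal 5)) (rvec 3 (iscal 5))) (rscal 5))))

/-- Computes the prices. -/
def startRound : Cmd :=
  .seq (.seq (setScalR 9 (rlit 0)) (.seq (setScalR 10 (rlit 0)) (setScalI 10 (iscal 1))))
    (.for 5 (.lit 0) 0 startRoundBody)

theorem startRound_runs {σ : Store} (h0 : σ.ints 0 0 0 = n) :
    Runs E startRound σ (n * 64 + 30) fun τ =>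
      τ.reals 9 0 0 = 0 ∧ τ.reals 10 0 0 = 0 ∧ τ.ints 10 0 0 = σ.ints 1 0 0 ∧
      ∀ i : Fin n, τ.reals 8 i 0 = 0 ∧ τ.reals 18 i 0 =
        price (σ.reals 0 0 0) (σ.reals 6 0 0) (σ.reals 5 0 0) (fun i : Fin n => 1 + σ.reals 3 i 0)
          (fun i => 1 + σ.reals 4 i 0) i := by
  have hz : Runs E (.seq (setScalR 9 (rlit 0)) (.seq (setScalR 10 (rlit 0))
      (setScalI 10 (iscal 1)))) σ 19
      fun τ => τ.reals 9 0 0 = 0 ∧ τ.reals 10 0 0 = 0 ∧ τ.ints 10 0 0 = σ.ints 1 0 0 :=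
    (Runs.of_run rfl (by simp [Cmd.run, IExp.eval, RExp.eval])).mono (by decide) fun τ _ h => h
  refine (Runs.seq (c' := n * 64 + 11) hz ?_).mono (by omega) fun τ _ h => h
  rintro τ hFτ ⟨h9, h10, h10'⟩
  refine (Runs.for (l := 0) (N := n) (c := 50)
    (fun k τ => ∀ i : Fin n, (i : ℕ) < k → τ.reals 8 i 0 = 0 ∧ τ.reals 18 i 0 =
        price (σ.reals 0 0 0) (σ.reals 6 0 0) (σ.reals 5 0 0) (fun i : Fin n => 1 + σ.reals 3 i 0)
          (fun i => 1 + σ.reals 4 i 0) i)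
    (by decide) (by decide) (by decide) rfl (by rw [hFτ.ints 0 (by decide), h0]) (Nat.zero_le _) ?_
    (fun _ h => by omega) ?_ ?_).mono ?_ fun τ _ h => h
  · intro k τ x h i hi
    simpa using h i hi
  · intro k ρ hF _ hk h5 h
    have e0 : ρ.reals 0 = σ.reals 0 := by rw [hF.reals 0 (by decide), hFτ.reals 0 (by decide)]
    have e6 : ρ.reals 6 = σ.reals 6 := by rw [hF.reals 6 (by decide), hFτ.reals 6 (by decide)]
    have e5 : ρ.reals 5 = σ.reals 5 := by rw [hF.reals 5 (by decide), hFτ.reals 5 (by decide)]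
    have e3 : ρ.reals 3 = σ.reals 3 := by rw [hF.reals 3 (by decide), hFτ.reals 3 (by decide)]
    have e4 : ρ.reals 4 = σ.reals 4 := by rw [hF.reals 4 (by decide), hFτ.reals 4 (by decide)]
    refine (Runs.of_run rfl ?_).mono (by decide) fun τ _ h => h
    intro i hi
    by_cases hik : (i : ℕ) = k
    · simp [startRoundBody, Cmd.run, IExp.eval, RExp.eval, h5, hik, price, e0, e6, e5, e3, e4]
    · have := h i (by omega)
      simp [startRoundBody, Cmd.run, IExp.eval, RExp.eval, h5, hik, this]
  · intro ρ hF h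
    refine ⟨?_, ?_, ?_, fun i => h i i.2⟩
    · rw [hF.reals 9 (by decide), h9]
    · rw [hF.reals 10 (by decide), h10]
    · rw [hF.ints 10 (by decide), h10']
  · simp [IExp.cost]; try ring_nf; try omega

def markBucketBody : Cmd :=
  .ite (.rle (rvec 7 (iscal 7)) (.sub (.add (rlit 1) (rvec 18 (iscal 5))) (rvec 18 (iscal 6))))
    -- Zeros are written too, because the row may hold remains of a rejected proposal.
    (.iset 3 (iscal 10) (iscal 6) (.lit 1)) (.iset 3 (iscal 10) (iscal 6) (.lit 0))

/-- Writes the characteristic vector of a bucket. -/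
def markBucket : Cmd := .for 6 (.lit 0) 0 markBucketBody

theorem markBucket_runs {σ : Store} {i : Fin n} {k T : ℕ} {π : Fin n → ℝ}
    (h0 : σ.ints 0 0 0 = n) (h5 : σ.ints 5 0 0 = i) (h7 : σ.ints 7 0 0 = k)
    (hT : σ.ints 10 0 0 = T) (hk : σ.reals 7 k 0 = 2 ^ k / 2)
    (hπ : ∀ j : Fin n, σ.reals 18 j 0 = π j) :
    Runs E markBucket σ (n * 64 + 11) fun τ =>
      (∀ e s, e ≠ T → τ.ints 3 e s = σ.ints 3 e s) ∧
      ∀ j : Fin n, τ.ints 3 T j ≠ 0 ↔ (2 : ℝ) ^ k / 2 ≤ 1 + π i - π j := by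
  refine (Runs.for (l := 0) (N := n) (c := 50)
    (fun l τ => (∀ e s, e ≠ T → τ.ints 3 e s = σ.ints 3 e s) ∧
      ∀ j : Fin n, (j : ℕ) < l → (τ.ints 3 T j ≠ 0 ↔ (2 : ℝ) ^ k / 2 ≤ 1 + π i - π j))
    (by decide) (by decide) (by decide) rfl h0 (Nat.zero_le _) ?_
    ⟨fun _ _ _ => rfl, fun _ h => by omega⟩ ?_ ?_).mono ?_ fun τ _ h => h
  · rintro l τ x ⟨h, h'⟩
    exact ⟨by simpa using h, by simpa using h'⟩
  · rintro l τ hF - hl h6 ⟨h, h'⟩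
    have e5 := hF.ints 5 (by decide)
    have e7 := hF.ints 7 (by decide)
    have e10 := hF.ints 10 (by decide)
    have f7 := hF.reals 7 (by decide)
    have f18 := hF.reals 18 (by decide)
    have hπl := hπ ⟨l, hl⟩
    simp only at hπl
    refine (Runs.of_run rfl ?_).mono (by decide) fun τ _ h => h
    have key : ∀ e s, (markBucketBody.run E τ).ints 3 e s = if e = T ∧ s = l then
        (if (2 : ℝ) ^ k / 2 ≤ 1 + π i - π ⟨l, hl⟩ then 1 else 0) else τ.ints 3 e s := by
      intro e s
      simp only [markBucketBody, Cmd.run, IExp.eval, RExp.eval, Test.holds, e5, e7, e10, h5, h6,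
        h7, hT, f7, f18, hk, hπ, hπl, Nat.cast_one]
      by_cases hw : (2 : ℝ) ^ k / 2 ≤ 1 + π i - π ⟨l, hl⟩ <;> simp [hw]
    refine ⟨fun e s he => ?_, fun j hj => ?_⟩
    · rw [key, if_neg (fun h => he h.1), h e s he]
    · rw [key]
      by_cases hjl : (j : ℕ) = l
      · have : j = ⟨l, hl⟩ := Fin.ext hjl
        subst this
        simp
      · rw [if_neg (fun h => hjl h.2)]
        exact h' j (by omega)
  · rintro τ - ⟨h, h'⟩
    exact ⟨h, fun j => h' j j.2⟩
  · simp [IExp.cost]; try ring_nf; try omega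

/-- Turns the bucket into an entry and adds its utility to the accumulators. -/
def evalBucket : Cmd :=
  -- An agent has weight 1 for itself, so the marking includes it at thresholds up to 1; it is
  -- removed here.
  .seq (.iset 3 (iscal 10) (iscal 5) (.lit 0)) <|
  .seq (.iset 2 (iscal 10) (.lit 0) (iscal 5)) <|
  .seq (.callUtility 12 (.lit 0) (.lit 0) (iscal 5) 3 (iscal 10)) <|
  .seq (setScalR 9 (.add (rscal 9) (.mul (rvec 7 (iscal 7)) (rscal 12)))) <|
  .seq (setScalR 10 (.add (rscal 10) (rscal 12)))
    (setVecR 8 (iscal 5) (.add (rvec 8 (iscal 5)) (rscal 12)))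

theorem evalBucket_runs {σ : Store} {i : Fin n} {k T : ℕ} {S : Finset (Fin n)}
    (h5 : σ.ints 5 0 0 = i) (h7 : σ.ints 7 0 0 = k) (hT : σ.ints 10 0 0 = T)
    (hS : ∀ j : Fin n, σ.ints 3 T j ≠ 0 ↔ j ∈ S) :
    Runs E evalBucket σ 90 fun τ =>
      (∀ e s, e ≠ T → τ.ints 3 e s = σ.ints 3 e s) ∧ (∀ e, e ≠ T → τ.ints 2 e 0 = σ.ints 2 e 0) ∧
      τ.ints 2 T 0 = i ∧ τ.rowSet n 3 T = S.erase i ∧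
      τ.reals 9 0 0 = σ.reals 9 0 0 + σ.reals 7 k 0 * E.u i (S.erase i) ∧
      τ.reals 10 0 0 = σ.reals 10 0 0 + E.u i (S.erase i) ∧
      ∀ j : Fin n, τ.reals 8 j 0 = σ.reals 8 j 0 + if i = j then E.u i (S.erase i) else 0 := by
  have h1 : ((σ.setInt 3 T i 0).setInt 2 T 0 i).rowSet n 3 T = S.erase i := by
    ext j
    simp only [Store.rowSet, mem_filter, mem_univ, true_and, mem_erase, setInt_ints, ← hS,
      Nat.reduceEqDiff, false_and, if_false]
    by_cases h : j = i
    · simp [h]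
    · simp [h, Fin.ext_iff.not.1 h]
  have h2 : ∀ (ρ : Store) (a r s : ℕ) (v : ℝ) (k : ℕ),
      (ρ.setReal a r s v).rowSet n 3 k = ρ.rowSet n 3 k := fun _ _ _ _ _ _ => rfl
  refine (Runs.of_run rfl ?_).mono (by decide) fun τ _ h => h
  simp only [evalBucket, Cmd.run, IExp.eval, RExp.eval, setInt_ints, setReal_ints,
    setReal_reals, setInt_reals, h5, h7, hT, h1, h2, utilityAnswer_val, erase_idem,
    Nat.reduceEqDiff, false_and, and_self, if_true, if_false, true_and, and_true]
  refine ⟨?_, ?_, fun j => ?_⟩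
  · intro e s he
    simp [he]
  · intro e he
    simp [he]
  · by_cases hij : i = j
    · simp [hij]
    · simp [hij, Fin.ext_iff.not.1 (Ne.symm hij)]

def subtractSharesBody : Cmd :=
  .seq (.callShare 13 (.lit 0) (.lit 0) (iscal 5) (iscal 6) 3 (iscal 10))
    (setVecR 8 (iscal 6) (.sub (rvec 8 (iscal 6)) (rscal 13)))

/-- Subtracts the shares in the current entry from the imbalances. -/
def subtractShares : Cmd := .for 6 (.lit 0) 0 subtractSharesBody

/-- A share call answers zero for agents outside the bundle, so the loop over all agents needs no
membership test. -/
theorem subtractShares_runs {σ : Store} {i : Fin n} {T : ℕ} {B : Finset (Fin n)}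
    (h0 : σ.ints 0 0 0 = n) (h5 : σ.ints 5 0 0 = i) (hT : σ.ints 10 0 0 = T) (hi : i ∉ B)
    (hB : σ.rowSet n 3 T = B) :
    Runs E subtractShares σ (n * 64 + 11) fun τ =>
      ∀ j : Fin n, τ.reals 8 j 0 = σ.reals 8 j 0 - if j ∈ B then E.h i j B else 0 := by
  refine (Runs.for (l := 0) (N := n) (c := 50)
    (fun l τ => ∀ j : Fin n, τ.reals 8 j 0 =
      if (j : ℕ) < l then σ.reals 8 j 0 - (if j ∈ B then E.h i j B else 0) else σ.reals 8 j 0)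
    (by decide) (by decide) (by decide) rfl h0 (Nat.zero_le _) ?_
    (fun _ => by simp) ?_ ?_).mono ?_ fun τ _ h => h
  · intro l τ x h
    simpa using h
  · intro l τ hF _ hl h6 h
    have e5 := hF.ints 5 (by decide)
    have e10 := hF.ints 10 (by decide)
    have hB' : τ.rowSet n 3 T = B := by
      rw [← hB]
      exact rowSet_congr fun s _ => by rw [hF.ints 3 (by decide)]
    have hans : shareAnswer E i l B = if (⟨l, hl⟩ : Fin n) ∈ B then E.h i ⟨l, hl⟩ B else 0 := by
      simp [shareAnswer, hl, erase_eq_of_notMem hi]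
    refine (Runs.of_run rfl ?_).mono (by decide) fun τ _ h => h
    intro j
    have hj := h j
    by_cases hjl : (j : ℕ) = l
    · have : j = ⟨l, hl⟩ := Fin.ext hjl
      subst this
      simp [subtractSharesBody, Cmd.run, IExp.eval, RExp.eval, h6, e5, h5, e10, hT, hB', hans, hj]
    · have h8 : (j : ℕ) < l + 1 ↔ (j : ℕ) < l := by omega
      simp [subtractSharesBody, Cmd.run, IExp.eval, RExp.eval, h6, hjl, hj, h8]
  · intro τ _ h j
    rw [h j, if_pos j.2]
  · simp [IExp.cost]; try ring_nf; try omega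

/-- Proposes one bucket. -/
def proposeBucket : Cmd :=
  .seq markBucket (.seq evalBucket (.seq subtractShares (setScalI 10 (.succ (iscal 10)))))

/-- In the store `τ`, the entries `L, …, T - 1` add up to `X`, the accumulators hold the welfare
and the imbalances of `X` and the value `V`, and the first `L` entries are those of `σ`. -/
structure Proposed (E : DataExchange n) (σ : Store) (L T : ℕ) (X : Fin n → Finset (Fin n) → ℝ)
    (V : ℝ) (τ : Store) : Prop where
  le : L ≤ T
  ints : τ.ints 10 0 0 = T
  sum_entry : ∑ e ∈ Ico L T, entry n τ e = X
  value : τ.reals 9 0 0 = V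
  welfare : τ.reals 10 0 0 = E.welfareHom X
  imbalance : ∀ j : Fin n, τ.reals 8 j 0 = E.imbalance j X
  agent : ∀ e < L, τ.ints 2 e 0 = σ.ints 2 e 0
  row : ∀ e < L, ∀ s, τ.ints 3 e s = σ.ints 3 e s

theorem Proposed.setInt {σ τ : Store} {L T : ℕ} {X : Fin n → Finset (Fin n) → ℝ} {V : ℝ}
    (P : Proposed E σ L T X V τ) {v : ℕ} (hv : v ≠ 2 ∧ v ≠ 3 ∧ v ≠ 10) (x : ℕ) :
    Proposed E σ L T X V (τ.setInt v 0 0 x) := by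
  obtain ⟨h2, h3, h10⟩ := hv
  refine ⟨P.le, by simp [h10.symm, P.ints], ?_, P.value, P.welfare, P.imbalance, ?_, ?_⟩
  · rw [← P.sum_entry]
    exact sum_congr rfl fun e _ => entry_congr (by simp [h2.symm]) (by simp [h3.symm])
  · intro e he
    simp [h2.symm, P.agent e he]
  · intro e he s
    simp [h3.symm, P.row e he s]

theorem proposeBucket_runs {σ τ : Store} {i : Fin n} {k L T : ℕ} {π : Fin n → ℝ}
    {X : Fin n → Finset (Fin n) → ℝ} {V : ℝ} (P : Proposed E σ L T X V τ)
    (h0 : τ.ints 0 0 0 = n) (h5 : τ.ints 5 0 0 = i) (h7 : τ.ints 7 0 0 = k)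
    (hk : τ.reals 7 k 0 = 2 ^ k / 2) (hπ : ∀ j : Fin n, τ.reals 18 j 0 = π j) :
    Runs E proposeBucket τ (n * 128 + 120) (Proposed E σ L (T + 1)
      (X + atom (i : ℕ) (bucket π i k)) (V + 2 ^ k / 2 * E.u i (bucket π i k))) := by
  refine (Runs.seq (markBucket_runs h0 h5 h7 P.ints hk hπ)
    (c' := 90 + (n * 64 + 11 + 7)) ?_).mono (by omega) fun τ _ h => h
  rintro τ₁ hF₁ ⟨a1, a2⟩
  refine Runs.seq (evalBucket_runs (i := i) (k := k) (T := T)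
    (S := univ.filter fun j => (2 : ℝ) ^ k / 2 ≤ 1 + π i - π j)
    (by rw [hF₁.ints 5 (by decide), h5]) (by rw [hF₁.ints 7 (by decide), h7])
    (by rw [hF₁.ints 10 (by decide), P.ints]) (by simpa using a2)) ?_
  rintro τ₂ hF₂ ⟨b3, b2, b2', bB, b9, b10, b8⟩
  rw [← bucket] at bB b9 b10
  rw [← bucket] at b8
  have hi := notMem_bucket π i k
  refine Runs.seq (subtractShares_runs (i := i) (T := T) (B := bucket π i k)
    (by rw [hF₂.ints 0 (by decide), hF₁.ints 0 (by decide), h0])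
    (by rw [hF₂.ints 5 (by decide), hF₁.ints 5 (by decide), h5])
    (by rw [hF₂.ints 10 (by decide), hF₁.ints 10 (by decide), P.ints]) hi bB) ?_
  rintro τ₃ hF₃ c8
  have c10 : τ₃.ints 10 0 0 = T := by
    rw [hF₃.ints 10 (by decide), hF₂.ints 10 (by decide), hF₁.ints 10 (by decide), P.ints]
  have c2 : τ₃.ints 2 = τ₂.ints 2 := hF₃.ints 2 (by decide)
  have c3 : τ₃.ints 3 = τ₂.ints 3 := hF₃.ints 3 (by decide)
  have hagent : ∀ e, e ≠ T → τ₃.ints 2 e 0 = τ.ints 2 e 0 := fun e he => by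
    rw [c2, b2 e he, hF₁.ints 2 (by decide)]
  have hrow : ∀ e s, e ≠ T → τ₃.ints 3 e s = τ.ints 3 e s := fun e s he => by
    rw [c3, b3 e s he, a1 e s he]
  have hrun : (setScalI 10 (.succ (iscal 10))).run E τ₃ = τ₃.setInt 10 0 0 (T + 1) := by
    simp [Cmd.run, IExp.eval, c10]
  refine (Runs.of_run rfl ?_).mono (by decide) fun τ _ h => h
  rw [hrun]
  refine ⟨P.le.trans (Nat.le_succ T), by simp, ?_, ?_, ?_, ?_, ?_, ?_⟩
  · rw [sum_Ico_succ_top P.le, ← P.sum_entry]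
    congr 1
    · refine sum_congr rfl fun e he => ?_
      have he' : e ≠ T := by rw [mem_Ico] at he; omega
      exact entry_congr (by simp [hagent e he']) fun s _ => by simp [hrow e s he']
    · have : (τ₃.setInt 10 0 0 (T + 1)).rowSet n 3 T = bucket π i k := by
        rw [← bB]
        exact rowSet_congr fun s _ => by simp [c3]
      rw [entry, this]
      simp [c2, b2']
  · simp only [setInt_reals]
    rw [hF₃.reals 9 (by decide), b9, hF₁.reals 9 (by decide), hF₁.reals 7 (by decide), P.value, hk]
  · simp only [setInt_reals]
    rw [hF₃.reals 10 (by decide), b10, hF₁.reals 10 (by decide), P.welfare, map_add,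
      welfareHom_atom E hi]
  · intro j
    simp only [setInt_reals]
    rw [c8, b8, hF₁.reals 8 (by decide), P.imbalance, map_add, imbalance_atom E hi]
    ring
  · intro e he
    have he' : e ≠ T := by have := P.le; omega
    simp [hagent e he', P.agent e he]
  · intro e he s
    have he' : e ≠ T := by have := P.le; omega
    simp [hrow e s he', P.row e he s]

/-- The sum over the agents with index less than `k`. -/
def partialSum {M : Type*} [AddCommMonoid M] (f : Fin n → M) (k : ℕ) : M :=
  ∑ i : Fin n, if (i : ℕ) < k then f i else 0

theorem partialSum_zero {M : Type*} [AddCommMonoid M] (f : Fin n → M) : partialSum f 0 = 0 := by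
  simp [partialSum]

theorem partialSum_full {M : Type*} [AddCommMonoid M] (f : Fin n → M) :
    partialSum f n = ∑ i, f i := by
  simp [partialSum]

theorem partialSum_succ {M : Type*} [AddCommMonoid M] (f : Fin n → M) {k : ℕ} (hk : k < n) :
    partialSum f (k + 1) = partialSum f k + f ⟨k, hk⟩ := by
  have h : ∀ i : Fin n, (if (i : ℕ) < k + 1 then f i else 0) =
      (if (i : ℕ) < k then f i else 0) + if i = ⟨k, hk⟩ then f i else 0 := by
    intro i
    have : i = ⟨k, hk⟩ ↔ (i : ℕ) = k := Fin.ext_iff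
    simp only [this]
    split_ifs <;> first | (exfalso; omega) | simp
  simp only [partialSum, h, sum_add_distrib]
  simp

/-- Proposes all buckets of all agents. -/
def propose : Cmd := .for 5 (.lit 0) 0 (.for 7 (.lit 0) 8 proposeBucket)

theorem propose_runs {σ : Store} {K L : ℕ} {π : Fin n → ℝ} (h0 : σ.ints 0 0 0 = n)
    (h8 : σ.ints 8 0 0 = K) (h10 : σ.ints 10 0 0 = L) (hV : σ.reals 9 0 0 = 0)
    (hW : σ.reals 10 0 0 = 0) (hb : ∀ j : Fin n, σ.reals 8 j 0 = 0)
    (hk : ∀ k < K, σ.reals 7 k 0 = 2 ^ k / 2) (hπ : ∀ j : Fin n, σ.reals 18 j 0 = π j) :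
    Runs E propose σ (n * (K * (n * 128 + 134) + 25) + 11)
      (Proposed E σ L (L + n * K) (proposal K π) (E.proposalValue K π)) := by
  refine (Runs.for (l := 0) (N := n) (c := K * (n * 128 + 134) + 11)
    (fun i => Proposed E σ L (L + i * K)
      (partialSum (fun i : Fin n => ∑ k ∈ range K, atom (i : ℕ) (bucket π i k)) i)
      (partialSum (fun i : Fin n => ∑ k ∈ range K, 2 ^ k / 2 * E.u i (bucket π i k)) i))
    (by decide) (by decide) (by decide) rfl h0 (Nat.zero_le _)
    (fun i τ x P => P.setInt (by decide) x) ?_ ?_ ?_).mono ?_ fun τ _ h => h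
  · rw [partialSum_zero, partialSum_zero]
    exact ⟨by omega, by simp [h10], by simp, hV, by simp [hW], by simpa using hb,
      fun _ _ => rfl, fun _ _ _ => rfl⟩
  · intro i τ hF _ hi h5 P
    refine (Runs.for (l := 0) (N := K) (c := n * 128 + 120)
      (fun k => Proposed E σ L (L + i * K + k)
        (partialSum (fun i : Fin n => ∑ k ∈ range K, atom (i : ℕ) (bucket π i k)) i +
          ∑ k ∈ range k, atom i (bucket π ⟨i, hi⟩ k))
        (partialSum (fun i : Fin n => ∑ k ∈ range K, 2 ^ k / 2 * E.u i (bucket π i k)) i +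
          ∑ k ∈ range k, 2 ^ k / 2 * E.u ⟨i, hi⟩ (bucket π ⟨i, hi⟩ k)))
      (by decide) (by decide) (by decide) rfl (by rw [hF.ints 8 (by decide), h8]) (Nat.zero_le _)
      (fun i τ x P => P.setInt (by decide) x) (by simpa using P) ?_ ?_).mono ?_ fun τ _ h => h
    · intro k ρ hFρ _ hkK h7 P
      refine (proposeBucket_runs (i := ⟨i, hi⟩) (k := k) (π := π) P
        (by rw [hFρ.ints 0 (by decide), hF.ints 0 (by decide), h0])
        (by rw [hFρ.ints 5 (by decide), h5]) h7
        (by rw [hFρ.reals 7 (by decide), hF.reals 7 (by decide), hk k hkK])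
        (by rw [hFρ.reals 18 (by decide), hF.reals 18 (by decide)]; exact hπ)).mono le_rfl ?_
      intro υ _ P'
      simp only [sum_range_succ, ← add_assoc]
      exact P'
    · intro υ _ P'
      rw [partialSum_succ _ hi, partialSum_succ _ hi, Nat.succ_mul, ← add_assoc]
      exact P'
    · simp [IExp.cost]; try ring_nf; try omega
  · intro τ _ P
    rw [partialSum_full, partialSum_full] at P
    exact P
  · simp [IExp.cost]; try ring_nf; try omega

def updateBody : Cmd :=
  .seq (setScalR 5 (.add (rscal 5) (.mul (rscal 16)
    (.mul (.sub (rvec 3 (iscal 5)) (rvec 4 (iscal 5))) (rvec 8 (iscal 5)))))) <|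
  .seq (setVecR 3 (iscal 5) (.add (rvec 3 (iscal 5))
    (.mul (.add (rlit 1) (rvec 3 (iscal 5))) (.mul (rscal 16) (rvec 8 (iscal 5))))))
    (setVecR 4 (iscal 5) (.sub (rvec 4 (iscal 5))
      (.mul (.add (rlit 1) (rvec 4 (iscal 5))) (.mul (rscal 16) (rvec 8 (iscal 5))))))

/-- Accepts the proposal and updates the weights. -/
def accept : Cmd :=
  .seq (.seq (setScalI 1 (iscal 10)) (.seq (setScalI 9 (.succ (iscal 9)))
    (setScalR 11 (.add (rscal 11) (rscal 10))))) (.for 5 (.lit 0) 0 updateBody)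

/-- Storing `p - 1` and `m - 1` lets zero-initialized memory stand for unit weights. The body
changes the total first, while the old weights of the agent are still available. -/
theorem accept_runs {σ : Store} (h0 : σ.ints 0 0 0 = n) :
    Runs E accept σ (n * 134 + 41) fun τ =>
      τ.ints 1 0 0 = σ.ints 10 0 0 ∧ τ.ints 9 0 0 = σ.ints 9 0 0 + 1 ∧
      τ.reals 11 0 0 = σ.reals 11 0 0 + σ.reals 10 0 0 ∧
      τ.reals 5 0 0 = σ.reals 5 0 0 + ∑ i : Fin n, σ.reals 16 0 0 *
        (((1 + σ.reals 3 i 0) - (1 + σ.reals 4 i 0)) * σ.reals 8 i 0) ∧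
      ∀ i : Fin n,
        1 + τ.reals 3 i 0 = (1 + σ.reals 3 i 0) * (1 + σ.reals 16 0 0 * σ.reals 8 i 0) ∧
        1 + τ.reals 4 i 0 = (1 + σ.reals 4 i 0) * (1 - σ.reals 16 0 0 * σ.reals 8 i 0) := by
  have hz : Runs E (.seq (setScalI 1 (iscal 10)) (.seq (setScalI 9 (.succ (iscal 9)))
      (setScalR 11 (.add (rscal 11) (rscal 10))))) σ 30
      fun τ => τ.ints 1 0 0 = σ.ints 10 0 0 ∧ τ.ints 9 0 0 = σ.ints 9 0 0 + 1 ∧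
        τ.reals 11 0 0 = σ.reals 11 0 0 + σ.reals 10 0 0 :=
    (Runs.of_run rfl (by simp [Cmd.run, IExp.eval, RExp.eval])).mono (by decide) fun τ _ h => h
  refine (Runs.seq (c' := n * 134 + 11) hz ?_).mono (by omega) fun τ _ h => h
  rintro τ hFτ ⟨h1, h9, h11⟩
  have t5 : τ.reals 5 = σ.reals 5 := hFτ.reals 5 (by decide)
  have t3 : τ.reals 3 = σ.reals 3 := hFτ.reals 3 (by decide)
  have t4 : τ.reals 4 = σ.reals 4 := hFτ.reals 4 (by decide)
  refine (Runs.for (l := 0) (N := n) (c := 120)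
    (fun k τ => τ.reals 5 0 0 = σ.reals 5 0 0 + partialSum (fun i : Fin n => σ.reals 16 0 0 *
        (((1 + σ.reals 3 i 0) - (1 + σ.reals 4 i 0)) * σ.reals 8 i 0)) k ∧
      ∀ i : Fin n,
        1 + τ.reals 3 i 0 = (1 + σ.reals 3 i 0) *
          (if (i : ℕ) < k then 1 + σ.reals 16 0 0 * σ.reals 8 i 0 else 1) ∧
        1 + τ.reals 4 i 0 = (1 + σ.reals 4 i 0) *
          (if (i : ℕ) < k then 1 - σ.reals 16 0 0 * σ.reals 8 i 0 else 1))
    (by decide) (by decide) (by decide) rfl (by rw [hFτ.ints 0 (by decide), h0]) (Nat.zero_le _) ?_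
    ?_ ?_ ?_).mono ?_ fun τ _ h => h
  · intro k τ x h
    simpa using h
  · rw [partialSum_zero, t5, t3, t4]
    simp
  · rintro k ρ hF - hk i5 ⟨h, h'⟩
    have e16 : ρ.reals 16 = σ.reals 16 := by rw [hF.reals 16 (by decide), hFτ.reals 16 (by decide)]
    have e8 : ρ.reals 8 = σ.reals 8 := by rw [hF.reals 8 (by decide), hFτ.reals 8 (by decide)]
    have hk' := h' ⟨k, hk⟩
    simp only [lt_irrefl, if_false, mul_one, add_right_inj] at hk'
    refine (Runs.of_run rfl ?_).mono (by decide) fun τ _ h => h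
    refine ⟨?_, fun i => ?_⟩
    · rw [partialSum_succ _ hk, ← add_assoc, ← h]
      simp [updateBody, Cmd.run, IExp.eval, RExp.eval, i5, e16, e8, hk']
    · by_cases hik : (i : ℕ) = k
      · have : i = ⟨k, hk⟩ := Fin.ext hik
        subst this
        simp only [updateBody, Cmd.run, IExp.eval, RExp.eval, setReal_ints, setReal_reals, i5, e16,
          e8, hk', Nat.reduceEqDiff, false_and, and_self, if_false, if_true, Nat.lt_succ_self,
          Nat.cast_one]
        constructor <;> ring
      · have h8 : (i : ℕ) < k + 1 ↔ (i : ℕ) < k := by omega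
        simp [updateBody, Cmd.run, IExp.eval, RExp.eval, i5, hik, h8, h' i]
  · rintro ρ hF ⟨h, h'⟩
    rw [partialSum_full] at h
    refine ⟨?_, ?_, ?_, h, fun i => by simpa using h' i⟩
    · rw [hF.ints 1 (by decide), h1]
    · rw [hF.ints 9 (by decide), h9]
    · rw [hF.reals 11 (by decide), h11]
  · simp [IExp.cost]; try ring_nf; try omega

/-- One round: computes a proposal and accepts it, or halves the guess. -/
def round : Cmd :=
  .seq startRound <| .seq propose <|
    .ite (.rle (.div (rscal 6) (rlit 8)) (rscal 9)) accept
      (setScalR 6 (.div (rscal 6) (rlit 2)))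

/-- The sum of the entries `L₀, …, L - 1`. -/
def entrySum (n L₀ : ℕ) (τ : Store) : Fin n → Finset (Fin n) → ℝ :=
  ∑ e ∈ Ico L₀ (τ.ints 1 0 0), entry n τ e

/-- The store `τ` represents the state after `m` rounds, `t` of which were accepted. -/
structure RoundState (E : DataExchange n) (σ : Store) (ε : ℝ) (K L₀ m : ℕ) (τ : Store) :
    Prop where
  -- `s` is the number of halvings, tied to the guess so that `Progress.le_guess` can bound it.
  count : ∃ s, m = τ.ints 9 0 0 + s ∧ 2 ^ s * τ.reals 6 0 0 = n
  length : τ.ints 1 0 0 = L₀ + τ.ints 9 0 0 * (n * K)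
  progress : Progress E ε K (τ.ints 9 0 0) (τ.reals 6 0 0) (τ.reals 5 0 0)
    (fun i => 1 + τ.reals 3 i 0) (fun i => 1 + τ.reals 4 i 0) (entrySum n L₀ τ)
  welfare : τ.reals 11 0 0 = E.welfareHom (entrySum n L₀ τ)
  agent : ∀ e < L₀, τ.ints 2 e 0 = σ.ints 2 e 0
  row : ∀ e < L₀, ∀ s, τ.ints 3 e s = σ.ints 3 e s

/-- A rejected proposal stays in memory beyond the recorded length, so it does not enter `entrySum`,
and the next round overwrites it. -/
theorem round_runs (hE : E.CrossMonotone) (hn : 2 ≤ n) {σ τ : Store} {ε : ℝ} {K L₀ m : ℕ}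
    (hε : 0 < ε) (hε1 : ε < 1) (hK0 : 1 ≤ K) (hK : (n : ℝ) / ε < 2 ^ K / 2)
    (R : RoundState E σ ε K L₀ m τ) (h0 : τ.ints 0 0 0 = n) (h8 : τ.ints 8 0 0 = K)
    (hr : τ.reals 0 0 0 = ε) (hk : ∀ k < K, τ.reals 7 k 0 = 2 ^ k / 2)
    (h16 : τ.reals 16 0 0 = stepSize n K ε) :
    Runs E round τ (n * (K * (n * 128 + 134) + 223) + 101)
      (RoundState E σ ε K L₀ (m + 1)) := by
  refine (Runs.seq (startRound_runs h0)
    (c' := (n * (K * (n * 128 + 134) + 25) + 11) + (10 + (n * 134 + 41))) ?_).mono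
    (by ring_nf; omega) fun τ _ h => h
  rintro τ₁ hF₁ ⟨a9, a10, a10', a⟩
  obtain ⟨⟨s, hs, hs'⟩, hlen, P, hW, hagent, hrow⟩ := R
  rw [hr] at a
  refine Runs.seq (propose_runs (K := K) (L := τ.ints 1 0 0)
    (π := price ε (τ.reals 6 0 0) (τ.reals 5 0 0) (fun i : Fin n => 1 + τ.reals 3 i 0)
          (fun i => 1 + τ.reals 4 i 0))
    (by rw [hF₁.ints 0 (by decide), h0]) (by rw [hF₁.ints 8 (by decide), h8]) a10' a9 a10
    (fun j => (a j).1) (by rw [hF₁.reals 7 (by decide)]; exact hk) (fun j => (a j).2)) ?_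
  rintro τ₂ hF₂ Q
  have i0 : τ₂.ints 0 0 0 = n := by rw [hF₂.ints 0 (by decide), hF₁.ints 0 (by decide), h0]
  have i1 : τ₂.ints 1 = τ.ints 1 := by rw [hF₂.ints 1 (by decide), hF₁.ints 1 (by decide)]
  have i9 : τ₂.ints 9 = τ.ints 9 := by rw [hF₂.ints 9 (by decide), hF₁.ints 9 (by decide)]
  have r3 : τ₂.reals 3 = τ.reals 3 := by rw [hF₂.reals 3 (by decide), hF₁.reals 3 (by decide)]
  have r4 : τ₂.reals 4 = τ.reals 4 := by rw [hF₂.reals 4 (by decide), hF₁.reals 4 (by decide)]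
  have r5 : τ₂.reals 5 = τ.reals 5 := by rw [hF₂.reals 5 (by decide), hF₁.reals 5 (by decide)]
  have r6 : τ₂.reals 6 = τ.reals 6 := by rw [hF₂.reals 6 (by decide), hF₁.reals 6 (by decide)]
  have r11 : τ₂.reals 11 = τ.reals 11 := by
    rw [hF₂.reals 11 (by decide), hF₁.reals 11 (by decide)]
  have r16 : τ₂.reals 16 = τ.reals 16 := by
    rw [hF₂.reals 16 (by decide), hF₁.reals 16 (by decide)]
  have hag : ∀ e < τ.ints 1 0 0, τ₂.ints 2 e 0 = τ.ints 2 e 0 := fun e he => by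
    rw [Q.agent e he, hF₁.ints 2 (by decide)]
  have hro : ∀ e < τ.ints 1 0 0, ∀ s, τ₂.ints 3 e s = τ.ints 3 e s := fun e he s => by
    rw [Q.row e he s, hF₁.ints 3 (by decide)]
  have hL₀ : L₀ ≤ τ.ints 1 0 0 := by omega
  have hold : ∑ e ∈ Ico L₀ (τ.ints 1 0 0), entry n τ₂ e = entrySum n L₀ τ :=
    sum_congr rfl fun e he => by
      have := (mem_Ico.1 he).2
      exact entry_congr (hag e this) fun s _ => hro e this s
  refine (Runs.ite (c := n * 134 + 41) (fun hb => ?_) fun hb => ?_).mono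
    (by simp [Test.cost, RExp.cost, IExp.cost]) fun τ _ h => h
  · simp only [Test.holds, RExp.eval, IExp.eval, Q.value, r6, Nat.cast_ofNat] at hb
    refine (accept_runs i0).mono le_rfl ?_
    rintro τ₃ hF₃ ⟨b1, b9, b11, b5, b⟩
    have j6 : τ₃.reals 6 = τ.reals 6 := by rw [hF₃.reals 6 (by decide), r6]
    have j2 : τ₃.ints 2 = τ₂.ints 2 := hF₃.ints 2 (by decide)
    have j3 : τ₃.ints 3 = τ₂.ints 3 := hF₃.ints 3 (by decide)
    have hX : entrySum n L₀ τ₃ = entrySum n L₀ τ + proposal K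
        (price ε (τ.reals 6 0 0) (τ.reals 5 0 0) (fun i : Fin n => 1 + τ.reals 3 i 0)
          (fun i => 1 + τ.reals 4 i 0)) := by
      rw [entrySum, b1, Q.ints, ← sum_Ico_consecutive _ hL₀ Q.le, ← hold, ← Q.sum_entry]
      congr 1 <;>
      exact sum_congr rfl fun e _ => entry_congr (by rw [j2]) fun s _ => by rw [j3]
    rw [r3, r4, r5, r16, h16] at b5
    rw [r3, r4, r16, h16] at b
    rw [i9] at b9
    refine ⟨⟨s, by omega, by rw [j6]; exact hs'⟩, ?_, ?_, ?_, ?_, ?_⟩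
    · rw [b1, Q.ints, b9, hlen]; ring
    · rw [hX, b9, j6]
      exact P.success hE hn hε hε1 hK0 hb (b := fun i => τ₂.reals 8 i 0) Q.imbalance
        (fun i => (b i).1) (fun i => (b i).2) b5
    · rw [hX, b11, r11, hW, Q.welfare, map_add]
    · intro e he
      rw [j2, hag e (by omega), hagent e he]
    · intro e he s
      rw [j3, hro e (by omega), hrow e he]
  · simp only [Test.holds, RExp.eval, IExp.eval, Q.value, r6, Nat.cast_ofNat, not_le] at hb
    have hrun : (setScalR 6 (.div (rscal 6) (rlit 2))).run E τ₂ =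
        τ₂.setReal 6 0 0 (τ.reals 6 0 0 / 2) := by
      simp [Cmd.run, IExp.eval, RExp.eval, r6]
    refine (Runs.of_run rfl ?_).mono (le_trans (by decide : _ ≤ 41) (by omega)) fun τ _ h => h
    rw [hrun]
    have hX : entrySum n L₀ (τ₂.setReal 6 0 0 (τ.reals 6 0 0 / 2)) = entrySum n L₀ τ := by
      rw [← hold, entrySum, setReal_ints, i1]
      rfl
    refine ⟨⟨s + 1, ?_, ?_⟩, ?_, ?_, ?_, ?_, ?_⟩
    · rw [setReal_ints, i9]; omega
    · simp only [setReal_reals, and_self, if_true]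
      rw [← hs', pow_succ]; ring
    · rw [setReal_ints, i1, i9, hlen]
    · rw [hX, setReal_ints, i9]
      simpa [r3, r4, r5] using P.failure hE hn hε hε1 hK hb
    · rw [hX]
      simpa [r11] using hW
    · intro e he
      rw [setReal_ints, hag e (by omega), hagent e he]
    · intro e he s
      rw [setReal_ints, hro e (by omega), hrow e he]

/-! ### The loop over rounds and the final scaling -/

def initRounds : Cmd :=
  .seq (setScalI 15 (iscal 1)) <|
  .seq (setScalR 6 (.ofInt (iscal 0))) <|
  .seq (setScalR 5 (.add (.ofInt (iscal 0)) (.ofInt (iscal 0))))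
    (setScalR 16 (.div (rscal 0) (.mul (rlit 16) (.mul
      (.mul (.ofInt (iscal 0)) (.ofInt (iscal 8))) (.mul (.ofInt (iscal 0)) (.ofInt (iscal 8)))))))

/-- The test whether further rounds are needed. -/
def moreRounds : Test :=
  .neg (.rle (.mul (.mul (rlit 256) (.ofInt (iscal 0))) (.mul
      (.mul (.ofInt (iscal 0)) (.ofInt (iscal 8))) (.mul (.ofInt (iscal 0)) (.ofInt (iscal 8)))))
    (.mul (.mul (.ofInt (iscal 9)) (rscal 0)) (rscal 0)))

/-- While the test holds, fewer than `T` rounds have been accepted. With `s` halvings, `ε ≤ 2 * g =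
2 * n / 2 ^ s` gives `s < 2 ^ s ≤ 2 * (n / ε) < N`. -/
theorem rounds_runs (hE : E.CrossMonotone) (hN : E.Normalized) (hn : 2 ≤ n) {σ : Store} {ε : ℝ}
    {K L₀ N T : ℕ} (hε : 0 < ε) (hε1 : ε < 1) (hK0 : 1 ≤ K) (hK : (n : ℝ) / ε < 2 ^ K / 2)
    (hNε : 2 * (n / ε) < N) (hT : 256 * (n : ℝ) * ((n * K) * (n * K)) ≤ T * ε * ε)
    (h0 : σ.ints 0 0 0 = n) (h8 : σ.ints 8 0 0 = K) (h1 : σ.ints 1 0 0 = L₀)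
    (h9 : σ.ints 9 0 0 = 0) (hr : σ.reals 0 0 0 = ε) (h3 : ∀ i, σ.reals 3 i 0 = 0)
    (h4 : ∀ i, σ.reals 4 i 0 = 0) (h11 : σ.reals 11 0 0 = 0)
    (hk : ∀ k < K, σ.reals 7 k 0 = 2 ^ k / 2) :
    Runs E (.seq initRounds (.loop moreRounds round)) σ
      ((T + N) * (n * (K * (n * 128 + 134) + 223) + 151) + 110) fun τ =>
        (∃ m ≤ T + N, RoundState E σ ε K L₀ m τ) ∧ τ.ints 15 0 0 = L₀ ∧
        256 * (n : ℝ) * ((n * K) * (n * K)) ≤ (τ.ints 9 0 0 : ℕ) * ε * ε := by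
  have hinit : Runs E initRounds σ 60 fun τ => τ.ints 15 0 0 = L₀ ∧ τ.reals 6 0 0 = n ∧
      τ.reals 5 0 0 = n + n ∧ τ.reals 16 0 0 = stepSize n K ε := by
    refine (Runs.of_run rfl ?_).mono (by decide) fun τ _ h => h
    simp [initRounds, Cmd.run, IExp.eval, RExp.eval, h0, h1, h8, hr, stepSize]
  refine (Runs.seq hinit (c' := (T + N - 0) * (n * (K * (n * 128 + 134) + 223) + 101 + 50) + 50)
    ?_).mono (by rw [Nat.sub_zero, add_assoc _ 101 50]; omega) fun τ _ h => h
  rintro τ hF ⟨a15, a6, a5, a16⟩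
  have a0 : τ.ints 0 0 0 = n := by rw [hF.ints 0 (by decide), h0]
  have a8 : τ.ints 8 0 0 = K := by rw [hF.ints 8 (by decide), h8]
  have a9 : τ.ints 9 0 0 = 0 := by rw [hF.ints 9 (by decide), h9]
  have a1 : τ.ints 1 0 0 = L₀ := by rw [hF.ints 1 (by decide), h1]
  have ar : τ.reals 0 0 0 = ε := by rw [hF.reals 0 (by decide), hr]
  have hX : entrySum n L₀ τ = 0 := by rw [entrySum, a1, Ico_self, sum_empty]
  have hguard : ∀ ρ, Frame round.intArrays round.realArrays τ ρ → (moreRounds.holds ρ ↔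
      ¬ 256 * (n : ℝ) * ((n * K) * (n * K)) ≤ (ρ.ints 9 0 0 : ℕ) * ε * ε) := by
    intro ρ hFρ
    have e0 : ρ.ints 0 0 0 = n := by rw [hFρ.ints 0 (by decide), a0]
    have e8 : ρ.ints 8 0 0 = K := by rw [hFρ.ints 8 (by decide), a8]
    have er : ρ.reals 0 0 0 = ε := by rw [hFρ.reals 0 (by decide), ar]
    simp only [moreRounds, Test.holds, RExp.eval, IExp.eval, e0, e8, er, Nat.cast_ofNat]
  have hlt : ∀ m ρ, Frame round.intArrays round.realArrays τ ρ → RoundState E σ ε K L₀ m ρ →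
      moreRounds.holds ρ → m < T + N := by
    intro m ρ hFρ R hb
    rw [hguard ρ hFρ, not_le] at hb
    obtain ⟨s, hs, hs'⟩ := R.count
    have ht : ρ.ints 9 0 0 < T := by
      have h : ((ρ.ints 9 0 0 : ℕ) : ℝ) * (ε * ε) < T * (ε * ε) := by
        rw [← mul_assoc, ← mul_assoc]; exact hb.trans_le hT
      exact_mod_cast lt_of_mul_lt_mul_right h (by positivity)
    have hsN : s < N := by
      have hle := R.progress.le_guess hE hN hε hε1
      have h2 : (2 : ℝ) ^ s ≤ 2 * (n / ε) := by
        rw [mul_div_assoc', le_div_iff₀ hε]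
        have : (2 : ℝ) ^ s * ε ≤ 2 ^ s * (2 * ρ.reals 6 0 0) :=
          mul_le_mul_of_nonneg_left hle (by positivity)
        linarith
      have h3 : (s : ℝ) < 2 ^ s := by exact_mod_cast Nat.lt_two_pow_self
      have h4 : (s : ℝ) < N := by linarith
      exact_mod_cast h4
    omega
  refine (Runs.loop (l := 0) (M := T + N) (c := n * (K * (n * 128 + 134) + 223) + 101)
    (I := fun m ρ => m ≤ T + N ∧ RoundState E σ ε K L₀ m ρ) ?_ ?_ ?_ ?_).mono ?_ fun τ _ h => h
  · refine ⟨Nat.zero_le _, ⟨0, by rw [a9], by rw [a6]; simp⟩, by rw [a1, a9]; simp, ?_, ?_, ?_, ?_⟩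
    · rw [hX, a9, a6, a5, hF.reals 3 (by decide), hF.reals 4 (by decide)]
      simp only [h3, h4, add_zero]
      exact Progress.init hn
    · rw [hX, map_zero, hF.reals 11 (by decide), h11]
    · intro e _
      rw [hF.ints 2 (by decide)]
    · intro e _ s
      rw [hF.ints 3 (by decide)]
  · rintro m ρ hFρ ⟨-, R⟩ hb
    exact hlt m ρ hFρ R hb
  · rintro m ρ hFρ ⟨hm, R⟩ hb
    have hmlt := hlt m ρ hFρ R hb
    refine (round_runs hE hn hε hε1 hK0 hK R (by rw [hFρ.ints 0 (by decide), a0])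
      (by rw [hFρ.ints 8 (by decide), a8]) (by rw [hFρ.reals 0 (by decide), ar])
      (by rw [hFρ.reals 7 (by decide), hF.reals 7 (by decide)]; exact hk)
      (by rw [hFρ.reals 16 (by decide), a16])).mono le_rfl fun τ _ h => ⟨hmlt, h⟩
  · rintro m ρ hFρ ⟨hm, R⟩ hb
    rw [hguard ρ hFρ, not_not] at hb
    exact ⟨⟨m, hm, R⟩, by rw [hFρ.ints 15 (by decide), a15], hb⟩
  · have : moreRounds.cost ≤ 50 := by decide
    gcongr

/-- Sets the probabilities of the proposed entries. -/
def finish : Cmd :=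
  .seq (setScalR 17 (.div (rscal 1) (.add (.mul (.ofInt (iscal 9)) (.ofInt (iscal 8)))
      (.mul (rlit 4) (.div (rscal 11) (rscal 6))))))
    (.for 14 (iscal 15) 1 (setVecR 2 (iscal 14) (rscal 17)))

/-- The common probability depends on the final welfare and round count, so it is written only now;
the entries before `L₀`, those of the matching, keep theirs. -/
theorem finish_runs {σ : Store} {L₀ L : ℕ} (h15 : σ.ints 15 0 0 = L₀) (h1 : σ.ints 1 0 0 = L)
    (hL : L₀ ≤ L) :
    Runs E finish σ ((L - L₀) * 30 + 50) fun τ =>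
      τ.output n = ∑ e ∈ range L₀, σ.reals 2 e 0 • entry n σ e +
        (σ.reals 1 0 0 / ((σ.ints 9 0 0 : ℕ) * (σ.ints 8 0 0 : ℕ) +
          4 * (σ.reals 11 0 0 / σ.reals 6 0 0))) • entrySum n L₀ σ := by
  set s := σ.reals 1 0 0 / ((σ.ints 9 0 0 : ℕ) * (σ.ints 8 0 0 : ℕ) +
          4 * (σ.reals 11 0 0 / σ.reals 6 0 0)) with hs
  have hz : Runs E (setScalR 17 (.div (rscal 1) (.add (.mul (.ofInt (iscal 9)) (.ofInt (iscal 8)))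
      (.mul (rlit 4) (.div (rscal 11) (rscal 6)))))) σ 30 fun τ => τ.reals 17 0 0 = s :=
    (Runs.of_run rfl (by simp [Cmd.run, IExp.eval, RExp.eval, hs])).mono (by decide)
      fun τ _ h => h
  refine (Runs.seq (c' := (L - L₀) * 30 + 13) hz ?_).mono (by omega) fun τ _ h => h
  intro τ hFτ h17
  refine (Runs.for (l := L₀) (N := L) (c := 16)
    (fun k τ => ∀ e, τ.reals 2 e 0 = if L₀ ≤ e ∧ e < k then s else σ.reals 2 e 0)
    (by decide) (by decide) (by decide) (by simp [IExp.eval, hFτ.ints 15 (by decide), h15])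
    (by rw [hFτ.ints 1 (by decide), h1]) hL ?_ ?_ ?_ ?_).mono ?_ fun τ _ h => h
  · intro k τ x h
    simpa using h
  · intro e
    rw [hFτ.reals 2 (by decide), if_neg (by omega)]
  · intro k ρ hF hk hkL h14 h
    have e17 : ρ.reals 17 0 0 = s := by rw [hF.reals 17 (by decide), h17]
    refine (Runs.of_run rfl ?_).mono (by decide) fun τ _ h => h
    intro e
    by_cases hek : e = k
    · simp [Cmd.run, IExp.eval, RExp.eval, h14, e17, hek, hk]
    · have h8 : e < k + 1 ↔ e < k := by omega
      simp [Cmd.run, IExp.eval, RExp.eval, h14, hek, h8, h e]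
  · intro ρ hF h
    have i1 : ρ.ints 1 0 0 = L := by rw [hF.ints 1 (by decide), hFτ.ints 1 (by decide), h1]
    have hent : ∀ e, entry n ρ e = entry n σ e := fun e => entry_congr
      (by rw [hF.ints 2 (by decide), hFτ.ints 2 (by decide)])
      fun s _ => by rw [hF.ints 3 (by decide), hFτ.ints 3 (by decide)]
    rw [output_eq_sum, i1, ← sum_range_add_sum_Ico _ hL, entrySum, h1, smul_sum]
    congr 1
    · refine sum_congr rfl fun e he => ?_
      rw [hent, h, if_neg (by rw [mem_range] at he; omega)]
    · refine sum_congr rfl fun e he => ?_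
      rw [hent, h, if_pos (mem_Ico.1 he)]
  · simp [IExp.cost]; try ring_nf; try omega

/-- The algorithm. -/
def program : Cmd :=
  .seq thresholds <| .seq pairTable <| .seq greedyMatching <|
    .seq (.seq initRounds (.loop moreRounds round)) finish

/-- There are `T + N = O(Z ^ 9)` rounds of cost `O(Z ^ 4)` each, whence the exponent 13; the other
phases are of lower order. -/
theorem program_cost_le {n N T Z : ℕ} (hZ : 1 ≤ Z) (hn : n ≤ Z) (hN : N = 2 * Z ^ 2 + 1)
    (hT : T = 256 * Z * ((Z * N) * (Z * N)) * Z * Z) :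
    (50 * N + 50) + ((n * (n * 94 + 25) + 11) +
      ((n * (n * (n * 54 + 25) + n * 54 + 164) + 11) +
        (((T + N) * (n * (N * (n * 128 + 134) + 223) + 151) + 110) +
          ((T + N) * (n * N) * 30 + 50)))) ≤ 4000000 * Z ^ 13 := by
  have hpow : ∀ k ≤ 13, Z ^ k ≤ Z ^ 13 := fun k hk => Nat.pow_le_pow_right hZ hk
  have hN' : N ≤ 3 * Z ^ 2 := by
    have := Nat.one_le_pow 2 Z hZ
    omega
  have hT' : T ≤ 2304 * Z ^ 9 := by
    calc T ≤ 256 * Z * ((Z * (3 * Z ^ 2)) * (Z * (3 * Z ^ 2))) * Z * Z := by rw [hT]; gcongr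
      _ = 2304 * Z ^ 9 := by ring
  have hTN : T + N ≤ 2307 * Z ^ 9 := by
    have : Z ^ 2 ≤ Z ^ 9 := Nat.pow_le_pow_right hZ (by norm_num)
    omega
  calc _ ≤ (50 * (3 * Z ^ 2) + 50) + ((Z * (Z * 94 + 25) + 11) +
      ((Z * (Z * (Z * 54 + 25) + Z * 54 + 164) + 11) +
        (((2307 * Z ^ 9) * (Z * ((3 * Z ^ 2) * (Z * 128 + 134) + 223) + 151) + 110) +
          ((2307 * Z ^ 9) * (Z * (3 * Z ^ 2)) * 30 + 50)))) := by gcongr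
    _ ≤ _ := by
      ring_nf
      have h0 := hpow 0 (by norm_num)
      have h1 := hpow 1 (by norm_num)
      have h2 := hpow 2 (by norm_num)
      have h3 := hpow 3 (by norm_num)
      have h9 := hpow 9 (by norm_num)
      have h10 := hpow 10 (by norm_num)
      have h12 := hpow 12 (by norm_num)
      rw [pow_zero] at h0
      rw [pow_one] at h1
      omega

end RealRAM

/-! ### Assembly of the algorithm -/

open RealRAM in
theorem mainTheorem10 :
    ∃ (prog : RealRAM.Cmd) (C : ℝ) (c d : ℕ), 0 < C ∧
      ∀ (n : ℕ) (E : DataExchange n), E.CrossMonotone → E.Normalized →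
      ∀ (ε β : ℝ), 0 < ε → ε < 1 → 0 < β → β ≤ 1 →
        ∃ (t : ℕ) (σ : RealRAM.Store),
          RealRAM.Exec E prog (RealRAM.Store.init n ε β) t σ ∧
          (t : ℝ) ≤ c * (n + 1 / ε) ^ d ∧
          DataExchange.IsLottery (σ.output n) ∧
          E.EpsBalanced ε (σ.output n) ∧
          E.IsWelfareApprox ε (C * Real.log (max (n : ℝ) (1 / ε)) / β) (σ.output n) ∧
          E.IsApproxStable 2 (1 - β) (σ.output n) := by
  refine ⟨RealRAM.program, 160 / Real.log 2, 4000000 * 2 ^ 13, 13,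
    div_pos (by norm_num) (Real.log_pos one_lt_two), ?_⟩
  intro n E hE hN ε β hε hε1 hβ hβ1
  -- A lone agent has only the empty bundle, of utility 0, against the normalization.
  have hn : 2 ≤ n := by
    obtain ⟨i, hi⟩ := hN
    by_contra h
    have : univ.erase i = ∅ := by
      ext j
      have : j = i := Fin.ext (by omega)
      simp [this]
    rw [this, E.u_empty] at hi
    exact zero_ne_one hi
  have hn' : (2 : ℝ) ≤ n := by exact_mod_cast hn
  set Z := ⌈(n : ℝ) + 1 / ε⌉₊ with hZdef
  have hinv : 0 < 1 / ε := by positivity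
  have hZ : (n : ℝ) + 1 / ε ≤ Z := Nat.le_ceil _
  have hnZ : (n : ℝ) ≤ Z := by linarith
  have hεZ : 1 / ε ≤ Z := by linarith
  -- Rounding up costs a factor 2, the source of `2 ^ 13` in the constant.
  have hZ2 : (Z : ℝ) ≤ 2 * (n + 1 / ε) := by
    have := Nat.ceil_lt_add_one (by positivity : 0 ≤ (n : ℝ) + 1 / ε)
    linarith
  have hnZ' : n ≤ Z := by exact_mod_cast hnZ
  -- `N` exceeds `2 * (n / ε)` and bounds both buckets and halvings; `T` is enough accepted rounds
  -- for every `K ≤ N`, because `1 ≤ Z * ε`.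
  set N := 2 * Z ^ 2 + 1 with hNdef
  set T := 256 * Z * ((Z * N) * (Z * N)) * Z * Z with hTdef
  have hNε : 2 * ((n : ℝ) / ε) < (N : ℕ) := by
    have h1 : (n : ℝ) / ε ≤ Z * Z := by
      rw [div_eq_mul_one_div]
      exact mul_le_mul hnZ hεZ hinv.le (Nat.cast_nonneg _)
    rw [hNdef]
    push_cast
    nlinarith
  have hT : ∀ K ≤ N, 256 * (n : ℝ) * ((n * K) * (n * K)) ≤ (T : ℕ) * ε * ε := by
    intro K hK
    have hK' : (K : ℝ) ≤ (N : ℕ) := by exact_mod_cast hK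
    have h1 : 1 ≤ (Z : ℝ) * ε := by rwa [div_le_iff₀ hε] at hεZ
    have h2 : ((T : ℕ) : ℝ) * ε * ε =
        256 * Z * ((Z * (N : ℕ)) * (Z * (N : ℕ))) * ((Z * ε) * (Z * ε)) := by
      rw [hTdef]; push_cast; ring
    rw [h2]
    calc 256 * (n : ℝ) * ((n * K) * (n * K))
        ≤ 256 * Z * ((Z * (N : ℕ)) * (Z * (N : ℕ))) := by gcongr
      _ ≤ 256 * Z * ((Z * (N : ℕ)) * (Z * (N : ℕ))) * ((Z * ε) * (Z * ε)) :=
        le_mul_of_one_le_right (by positivity) (by nlinarith)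
  have main : Runs E program (Store.init n ε β)
      ((50 * N + 50) + ((n * (n * 94 + 25) + 11) +
        ((n * (n * (n * 54 + 25) + n * 54 + 164) + 11) +
          (((T + N) * (n * (N * (n * 128 + 134) + 223) + 151) + 110) +
            ((T + N) * (n * N) * 30 + 50))))) fun σ => DataExchange.IsLottery (σ.output n) ∧
          E.EpsBalanced ε (σ.output n) ∧
          E.IsWelfareApprox ε (160 / Real.log 2 * Real.log (max (n : ℝ) (1 / ε)) / β)
            (σ.output n) ∧
          E.IsApproxStable 2 (1 - β) (σ.output n) := by
    refine Runs.seq (thresholds_runs hn hε hε1 hNε (by simp [Store.init]) (by simp [Store.init])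
      (by simp [Store.init])) ?_
    rintro σ₁ hF₁ ⟨K, k8, hK0, hKN, hK4, hK2, hk⟩
    refine Runs.seq (pairTable_runs (by rw [hF₁.ints 0 (by decide)]; simp [Store.init])
      (fun r s _ => by rw [hF₁.ints 4 (by decide)]; simp [Store.init])) ?_
    intro σ₂ hF₂ htab
    refine Runs.seq (greedyMatching_runs (β := β) (by omega) hβ1
      (by rw [hF₂.ints 0 (by decide), hF₁.ints 0 (by decide)]; simp [Store.init])
      (by rw [hF₂.ints 1 (by decide), hF₁.ints 1 (by decide)]; simp [Store.init])
      (fun e s => by rw [hF₂.ints 3 (by decide), hF₁.ints 3 (by decide)]; simp [Store.init])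
      (by rw [hF₂.reals 1 (by decide), hF₁.reals 1 (by decide)]; simp [Store.init])
      (fun i j => (htab i j).1) (fun i j => (htab i j).2)) ?_
    rintro σ₃ hF₃ ⟨D, M, hD⟩
    refine Runs.seq ((rounds_runs (K := K) (L₀ := σ₃.ints 1 0 0) (T := T) hE hN hn hε hε1 hK0 hK2
      hNε (hT K hKN)
      (by rw [hF₃.ints 0 (by decide), hF₂.ints 0 (by decide), hF₁.ints 0 (by decide)]
          simp [Store.init])
      (by rw [hF₃.ints 8 (by decide), hF₂.ints 8 (by decide), k8]) rfl
      (by rw [hF₃.ints 9 (by decide), hF₂.ints 9 (by decide), hF₁.ints 9 (by decide)]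
          simp [Store.init])
      (by rw [hF₃.reals 0 (by decide), hF₂.reals 0 (by decide), hF₁.reals 0 (by decide)]
          simp [Store.init])
      (fun i => by
        rw [hF₃.reals 3 (by decide), hF₂.reals 3 (by decide), hF₁.reals 3 (by decide)]
        simp [Store.init])
      (fun i => by
        rw [hF₃.reals 4 (by decide), hF₂.reals 4 (by decide), hF₁.reals 4 (by decide)]
        simp [Store.init])
      (by rw [hF₃.reals 11 (by decide), hF₂.reals 11 (by decide), hF₁.reals 11 (by decide)]
          simp [Store.init])
      (by rw [hF₃.reals 7 (by decide), hF₂.reals 7 (by decide)]; exact hk)).mono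
      (by gcongr) fun τ _ h => h) ?_
    rintro σ₄ hF₄ ⟨⟨m, hm, R⟩, h15, hfin⟩
    have htm : σ₄.ints 9 0 0 ≤ T + N := by
      obtain ⟨s, hs, -⟩ := R.count
      omega
    refine (finish_runs h15 R.length (Nat.le_add_right _ _)).mono ?_ ?_
    · rw [Nat.add_sub_cancel_left]
      gcongr
    intro σ₅ _ hout
    refine DataExchange.output_spec hn hε hβ hβ1 R.progress hK0 hK4 hfin M hD ?_
    rw [hout, output_eq_sum, R.welfare, hF₄.reals 1 (by decide), hF₃.reals 1 (by decide),
      hF₂.reals 1 (by decide), hF₁.reals 1 (by decide), hF₄.ints 8 (by decide),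
      hF₃.ints 8 (by decide), hF₂.ints 8 (by decide), k8, hF₄.reals 2 (by decide)]
    congr 1
    · refine sum_congr rfl fun e he => ?_
      have he' := mem_range.1 he
      rw [entry_congr (R.agent e he') fun s _ => R.row e he' s]
  obtain ⟨t', σ, hexec, ht', hσ⟩ := main
  refine ⟨t', σ, hexec, ?_, hσ⟩
  have hcost := ht'.trans (program_cost_le (by omega) hnZ' hNdef hTdef)
  calc (t' : ℝ) ≤ ((4000000 * Z ^ 13 : ℕ) : ℝ) := by exact_mod_cast hcost
    _ = 4000000 * (Z : ℝ) ^ 13 := by push_cast; ring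
    _ ≤ 4000000 * (2 * (n + 1 / ε)) ^ 13 := by gcongr
    _ = _ := by push_cast; ring
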